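/- **Theorem 2 (Convergence of R-WMMSE).** Let $K, M, N_k, D_k$ ($1\le k\le K$) be numbers of users, transmit antennas, receive antennas and streams, $N=\sum_k N_k$, $D=\sum_k D_k$. Let $\alpha_k>0$, $\sigma_k>0$, $P_{\max}>0$, $H_k\in\mathbb{C}^{N_k\times M}$, and assume that $H=[H_1^T,\dots,H_K^T]^T\in\mathbb{C}^{N\times M}$ has full row rank. Put $\bar H=HH^H$ and $\bar H_k=H_kH^H$. The weighted sum-rate (WSR) problem under a sum power constraint (SPC) is $$\max_{P=[P_1,\dots,P_K],\ P_k\in\mathbb{C}^{M\times D_k}}\ \sum_k\alpha_k\log\det\Big(I+H_kP_kP_k^HH_k^H\Big(\sum_{j\ne k}H_kP_jP_j^HH_k^H+\sigma_k^2I\Big)^{-1}\Big)\quad\text{s.t. }\sum_k\operatorname{Tr}(P_kP_k^H)\le P_{\max}.\tag{1}$$ A stationary point of (1) is a point satisfying its KKT conditions, and it is nontrivial if $H_kP_k\ne 0$ for some $k$. The weighted sum-MSE problem is $$\min_{U,W,X}\ \sum_k\alpha_k\big(\operatorname{Tr}(W_kE'_k)-\log\det W_k\big)\tag{2}$$ over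 $U_k\in\mathbb{C}^{N_k\times D_k}$, Hermitian positive definite $W_k\in\mathbb{C}^{D_k\times D_k}$ and $X=[X_1,\dots,X_K]$, $X_k\in\mathbb{C}^{N\times D_k}$, where $$E'_k=(I-U_k^H\bar H_kX_k)(I-U_k^H\bar H_kX_k)^H+U_k^H\Big(\sum_{j\ne k}\bar H_kX_jX_j^H\bar H_k^H+\frac{\sigma_k^2}{P_{\max}}\sum_i\operatorname{Tr}(\bar HX_iX_i^H)\,I\Big)U_k .$$ A stationary point of (2) is a point of this domain at which the gradient of the objective in $(U,W,X)$, with $W$ ranging over Hermitian matrices, vanishes. The R-WMMSE algorithm starts from $W_k=I$ and an $X$ with $\sum_k\operatorname{Tr}(\bar HX_kX_k^H)\le P_{\max}$ and $\bar H_kX_k\neq0$ for at least one $k$, and in each iteration performs, in this order, $$U_k\leftarrow\Big(\sum_i\tfrac{\sigma_k^2}{P_{\max}}\operatorname{Tr}(\bar HX_iX_i^H)I+\sum_j\bar H_kX_jX_j^H\bar H_k^H\Big)^{-1}\bar H_kX_k,\qquad W_k\leftarrow\big(I-U_k^H\bar H_kX_k\big)^{-1}\quad\forall k,$$ $$X\leftarrow\hat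 U\big(\eta\hat W^{-1}+\hat U^H\bar H\hat U\big)^{-1},$$ where $\hat U=\operatorname{blkdiag}(U_1,\dots,U_K)$, $\hat W=\operatorname{blkdiag}(\alpha_1W_1,\dots,\alpha_KW_K)$ and $\eta=\sum_i\frac{\sigma_i^2}{P_{\max}}\alpha_i\operatorname{Tr}(U_iW_iU_i^H)$. Then every limit point $(U^\star,W^\star,X^\star)$ of the sequence of iterates $(U,W,X)$ (run without a stopping test) is a stationary point of (2). Moreover $\sum_k\operatorname{Tr}(\bar HX^\star_k(X^\star_k)^H)>0$, and with $\beta=P_{\max}/\sum_k\operatorname{Tr}(\bar HX^\star_k(X^\star_k)^H)$ the point $P^\star=\sqrt{\beta}\,H^HX^\star$ is a nontrivial stationary point of (1). -/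

import Mathlib

open Matrix Filter Topology
open scoped ComplexOrder

noncomputable section

/-- Data of a downlink MU-MIMO system with `K` users and `M` transmit antennas, where user `k` has
`N k` receive antennas and `D k` data streams: channels `H k`, user weights `α k`, noise standard
deviations `σ k` (the noise variance is `σ k ^ 2`) and the total power budget `Pmax`. -/
structure MUMIMO (K M : ℕ) (N D : Fin K → ℕ) where
  H : ∀ k, Matrix (Fin (N k)) (Fin M) ℂ
  α : Fin K → ℝ
  σ : Fin K → ℝ
  Pmax : ℝ

namespace MUMIMO

/-- Rows of the stacked channel: pairs (user, receive antenna); there are `∑ k, N k` of them. -/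
abbrev Rx {K : ℕ} (N : Fin K → ℕ) : Type := Σ k, Fin (N k)

/-- All data streams: pairs (user, stream); there are `∑ k, D k` of them. -/
abbrev Streams {K : ℕ} (D : Fin K → ℕ) : Type := Σ k, Fin (D k)

/-- The `k`-th block column `A_k` of `A = [A_1, …, A_K]`. -/
def col {K : ℕ} {D : Fin K → ℕ} {m : Type} (A : Matrix m (Streams D) ℂ) (k : Fin K) :
    Matrix m (Fin (D k)) ℂ :=
  A.submatrix id fun d => (⟨k, d⟩ : Streams D)

variable {K M : ℕ} {N D : Fin K → ℕ} (S : MUMIMO K M N D)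

/-- The stacked channel `H = [H_1ᵀ, …, H_Kᵀ]ᵀ`. -/
def Hs : Matrix (Rx N) (Fin M) ℂ := Matrix.of fun p j => S.H p.1 p.2 j

/-- `H` has full row rank. -/
def FullRowRank : Prop := S.Hs.rank = Fintype.card (Rx N)

/-! ### The weighted sum-rate problem under a sum power constraint -/

/-- Interference plus noise covariance `∑_{j ≠ k} H_k P_j P_jᴴ H_kᴴ + σ_k² I`. -/
def noiseCov (P : Matrix (Fin M) (Streams D) ℂ) (k : Fin K) : Matrix (Fin (N k)) (Fin (N k)) ℂ :=
  ∑ j ∈ Finset.univ.erase k, S.H k * col P j * (col P j)ᴴ * (S.H k)ᴴ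
    + ((S.σ k ^ 2 : ℝ) : ℂ) • (1 : Matrix (Fin (N k)) (Fin (N k)) ℂ)

/-- The rate `R_k = log det (I + H_k P_k P_kᴴ H_kᴴ (noiseCov)⁻¹)`; the determinant is a real
number `≥ 1` when `σ k ≠ 0`. -/
def rate (P : Matrix (Fin M) (Streams D) ℂ) (k : Fin K) : ℝ :=
  Real.log (1 + S.H k * col P k * (col P k)ᴴ * (S.H k)ᴴ * (S.noiseCov P k)⁻¹).det.re

/-- The weighted sum-rate. -/
def wsr (P : Matrix (Fin M) (Streams D) ℂ) : ℝ := ∑ k, S.α k * S.rate P k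

/-- Total transmit power `∑_k Tr (P_k P_kᴴ)`. -/
def power (P : Matrix (Fin M) (Streams D) ℂ) : ℝ := ∑ k, (col P k * (col P k)ᴴ).trace.re

/-- `P` is a stationary (KKT) point of: maximize `wsr P` subject to `power P ≤ Pmax`.
Derivatives are taken with respect to the real vector space structure. -/
def IsStationaryWSR (P : Matrix (Fin M) (Streams D) ℂ) : Prop :=
  power P ≤ S.Pmax ∧
  ∃ l : ℝ, 0 ≤ l ∧ l * (power P - S.Pmax) = 0 ∧
    HasFDerivAt (𝕜 := ℝ) (fun Q => S.wsr Q - l * (power Q - S.Pmax))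
      (0 : Matrix (Fin M) (Streams D) ℂ →L[ℝ] ℝ) P

/-- `P` is trivial: `H_k P_k = 0` for all `k`. -/
def IsTrivial (P : Matrix (Fin M) (Streams D) ℂ) : Prop := ∀ k, S.H k * col P k = 0

/-! ### The reduced weighted sum-MSE problem -/

/-- `H̄ = H Hᴴ`. -/
def Hbar : Matrix (Rx N) (Rx N) ℂ := S.Hs * S.Hsᴴ

/-- `H̄_k = H_k Hᴴ`. -/
def Hbark (k : Fin K) : Matrix (Fin (N k)) (Rx N) ℂ := S.H k * S.Hsᴴ

/-- `∑_i Tr (H̄ X_i X_iᴴ)`, which is the power of the precoder `Hᴴ X`. -/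
def redPower (X : Matrix (Rx N) (Streams D) ℂ) : ℝ :=
  ∑ i, (S.Hbar * col X i * (col X i)ᴴ).trace.re

/-- `N'_k = ∑_{j ≠ k} H̄_k X_j X_jᴴ H̄_kᴴ + (σ_k² / Pmax) ∑_i Tr (H̄ X_i X_iᴴ) I`. -/
def redNoise (X : Matrix (Rx N) (Streams D) ℂ) (k : Fin K) : Matrix (Fin (N k)) (Fin (N k)) ℂ :=
  ∑ j ∈ Finset.univ.erase k, S.Hbark k * col X j * (col X j)ᴴ * (S.Hbark k)ᴴ
    + ((S.σ k ^ 2 / S.Pmax * S.redPower X : ℝ) : ℂ) • (1 : Matrix (Fin (N k)) (Fin (N k)) ℂ)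

/-- The matrix `E'_k`. -/
def mse (U : ∀ k, Matrix (Fin (N k)) (Fin (D k)) ℂ) (X : Matrix (Rx N) (Streams D) ℂ)
    (k : Fin K) : Matrix (Fin (D k)) (Fin (D k)) ℂ :=
  (1 - (U k)ᴴ * S.Hbark k * col X k) * (1 - (U k)ᴴ * S.Hbark k * col X k)ᴴ
    + (U k)ᴴ * S.redNoise X k * U k

/-- The variables `(U, W, X)` of the reduced weighted sum-MSE problem. -/
abbrev Vars (N D : Fin K → ℕ) : Type :=
  (∀ k, Matrix (Fin (N k)) (Fin (D k)) ℂ) × (∀ k, Matrix (Fin (D k)) (Fin (D k)) ℂ) ×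
    Matrix (Rx N) (Streams D) ℂ

/-- The weighted sum-MSE objective `∑_k α_k (Tr (W_k E'_k) - log det W_k)`; both the trace and the
determinant are real when every `W_k` is positive definite. -/
def wmse (z : Vars N D) : ℝ :=
  ∑ k, S.α k * ((z.2.1 k * S.mse z.1 z.2.2 k).trace.re - Real.log (z.2.1 k).det.re)

/-- The domain of the objective: every `W_k` is (Hermitian and) positive definite. -/
def wmseDomain (N D : Fin K → ℕ) : Set (Vars N D) := {z | ∀ k, (z.2.1 k).PosDef}

/-- Stationary point of the minimization of `wmse`: a point `z` of the domain at which
`wmse y - wmse z = o(‖y - z‖)` as `y → z` in the domain, i.e. the gradient in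
`(U, W, X)`, with `W` ranging over Hermitian matrices, vanishes. -/
def IsStationaryWMSE (z : Vars N D) : Prop :=
  z ∈ wmseDomain N D ∧
    HasFDerivWithinAt (𝕜 := ℝ) S.wmse (0 : Vars N D →L[ℝ] ℝ) (wmseDomain N D) z

/-! ### The R-WMMSE algorithm -/

/-- The update of `U`. -/
def updU (X : Matrix (Rx N) (Streams D) ℂ) (k : Fin K) : Matrix (Fin (N k)) (Fin (D k)) ℂ :=
  (((∑ i, S.σ k ^ 2 / S.Pmax * (S.Hbar * col X i * (col X i)ᴴ).trace.re : ℝ) : ℂ) •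
      (1 : Matrix (Fin (N k)) (Fin (N k)) ℂ)
    + ∑ j, S.Hbark k * col X j * (col X j)ᴴ * (S.Hbark k)ᴴ)⁻¹ * (S.Hbark k * col X k)

/-- The update of `W`. -/
def updW (U : ∀ k, Matrix (Fin (N k)) (Fin (D k)) ℂ) (X : Matrix (Rx N) (Streams D) ℂ)
    (k : Fin K) : Matrix (Fin (D k)) (Fin (D k)) ℂ :=
  (1 - (U k)ᴴ * S.Hbark k * col X k)⁻¹

/-- `η = ∑_i (σ_i² / Pmax) α_i Tr (U_i W_i U_iᴴ)`. -/
def eta (U : ∀ k, Matrix (Fin (N k)) (Fin (D k)) ℂ)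
    (W : ∀ k, Matrix (Fin (D k)) (Fin (D k)) ℂ) : ℝ :=
  ∑ i, S.σ i ^ 2 / S.Pmax * S.α i * (U i * W i * (U i)ᴴ).trace.re

/-- `Û = blkdiag (U_1, …, U_K)`. -/
def blkU (U : ∀ k, Matrix (Fin (N k)) (Fin (D k)) ℂ) : Matrix (Rx N) (Streams D) ℂ :=
  Matrix.blockDiagonal' U

/-- `Ŵ = blkdiag (α_1 W_1, …, α_K W_K)`. -/
def blkW (W : ∀ k, Matrix (Fin (D k)) (Fin (D k)) ℂ) : Matrix (Streams D) (Streams D) ℂ :=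
  Matrix.blockDiagonal' fun k => (S.α k : ℂ) • W k

/-- The update of `X`: `X = Û (η Ŵ⁻¹ + Ûᴴ H̄ Û)⁻¹`. -/
def updX (U : ∀ k, Matrix (Fin (N k)) (Fin (D k)) ℂ)
    (W : ∀ k, Matrix (Fin (D k)) (Fin (D k)) ℂ) : Matrix (Rx N) (Streams D) ℂ :=
  blkU U * ((S.eta U W : ℂ) • (S.blkW W)⁻¹ + (blkU U)ᴴ * S.Hbar * blkU U)⁻¹

/-- `z n = (U, W, X)` is the state of the R-WMMSE algorithm after `n` iterations. The initial `X` is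
within the power budget and `H̄_k X_k ≠ 0` for at least one `k` (otherwise a matrix to be inverted
in the first iteration is zero); the initial `U` is never used, hence arbitrary. -/
structure IsRWMMSE (z : ℕ → Vars N D) : Prop where
  init_power : S.redPower (z 0).2.2 ≤ S.Pmax
  init_ne : ∃ k, S.Hbark k * col (z 0).2.2 k ≠ 0
  init_W : (z 0).2.1 = fun _ => 1
  step_U : ∀ n, (z (n + 1)).1 = S.updU (z n).2.2
  step_W : ∀ n, (z (n + 1)).2.1 = S.updW (z (n + 1)).1 (z n).2.2
  step_X : ∀ n, (z (n + 1)).2.2 = S.updX (z (n + 1)).1 (z (n + 1)).2.1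

/-- The scaling factor `β = Pmax / ∑_k Tr (H̄ X_k X_kᴴ)`. -/
def beta (X : Matrix (Rx N) (Streams D) ℂ) : ℝ := S.Pmax / S.redPower X

/-- The precoder `√β Hᴴ X`. -/
def precoder (X : Matrix (Rx N) (Streams D) ℂ) : Matrix (Fin M) (Streams D) ℂ :=
  ((Real.sqrt (S.beta X) : ℝ) : ℂ) • (S.Hsᴴ * X)

end MUMIMO

end

/-! The argument treats the method as block minimization of one objective. With the effective
precoder `P = Hᴴ X`, problem (2) is the usual weighted MSE problem whose noise variances are
proportional to the power of `P`. For fixed `X`, completing the square in `U_k` and using `log x ≤ x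
- 1` on eigenvalues for `W_k` shows that the `U`, `W` updates attain the minimum, `weightedStreams`
minus the weighted sum-rate (`wmseWith_ge`, `wmseWith_mmse`). For fixed `U`, `W` the objective is a
convex quadratic in `P`, and the `X` update solves its normal equations, so it is optimal among all
precoders (`updX_normal`, `wmseWith_le`).

Hence the objective decreases. A precoder that delivers no signal costs at least `weightedStreams`,
while the first iterate is strictly below that value, so the signal survives every iteration and
every limit. The weights satisfy `W_k ⪰ I`, a closed condition, so limit weights stay positive
definite and the objective is continuous there. Both optimality inequalities therefore pass to a
limit point (`IsRWMMSE.limit`).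

Minimality in `(U, W)` and in `X` separately makes the derivative vanish, which is stationarity for
(2). For (1), freeze the noise: the MSE objective plus the sum-rate, and the MSE objective plus
`eta` times the power, are both minimal at `Hᴴ X`, so the sum-rate and `eta` times the power have
equal gradients. Scaling by `√β` restores the true noise and full power, with multiplier `eta / β`.
-/

noncomputable section

set_option linter.unusedSectionVars false

namespace Matrix

/-! ### The single-user weighted MSE problem and its minimum -/

section SingleUser

variable {n d : Type*} [Fintype n] [DecidableEq n] [Fintype d] [DecidableEq d]

open scoped MatrixOrder in
theorem PosSemidef.exists_eq_conjTranspose_mul_self {A : Matrix n n ℂ} (hA : A.PosSemidef) :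
    ∃ B : Matrix n n ℂ, A = Bᴴ * B :=
  CStarAlgebra.nonneg_iff_eq_star_mul_self.mp hA.nonneg

theorem PosDef.exists_eq_conjTranspose_mul_self {A : Matrix n n ℂ} (hA : A.PosDef) :
    ∃ B : Matrix n n ℂ, IsUnit B.det ∧ A = Bᴴ * B := by
  obtain ⟨B, hB⟩ := hA.posSemidef.exists_eq_conjTranspose_mul_self
  refine ⟨B, ?_, hB⟩
  have h := (isUnit_iff_isUnit_det _).1 hA.isUnit
  rw [hB, det_mul] at h
  exact isUnit_of_mul_isUnit_right h

theorem PosDef.det_eq_re {A : Matrix n n ℂ} (hA : A.PosDef) : ((A.det.re : ℝ) : ℂ) = A.det := by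
  have h := Complex.lt_def.1 hA.det_pos
  apply Complex.ext <;> simp [← h.2]

theorem PosDef.det_re_pos {A : Matrix n n ℂ} (hA : A.PosDef) : 0 < A.det.re :=
  (Complex.lt_def.1 hA.det_pos).1

theorem PosSemidef.trace_re_nonneg {A : Matrix n n ℂ} (hA : A.PosSemidef) : 0 ≤ A.trace.re :=
  (Complex.le_def.1 hA.trace_nonneg).1

theorem PosSemidef.trace_re_eq_zero {A : Matrix n n ℂ} (hA : A.PosSemidef)
    (h : A.trace.re = 0) : A = 0 := by
  refine hA.trace_eq_zero_iff.1 (Complex.ext h ?_)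
  exact (Complex.le_def.1 hA.trace_nonneg).2.symm

theorem PosDef.isUnit_det {A : Matrix n n ℂ} (hA : A.PosDef) : IsUnit A.det :=
  (isUnit_iff_isUnit_det _).1 hA.isUnit

theorem PosDef.trace_sub_log_det {M : Matrix d d ℂ} (hM : M.PosDef) :
    M.trace.re - Real.log M.det.re
      = ∑ i, (hM.isHermitian.eigenvalues i - Real.log (hM.isHermitian.eigenvalues i)) := by
  have hd : M.det = ((∏ i, hM.isHermitian.eigenvalues i : ℝ) : ℂ) := by
    rw [hM.isHermitian.det_eq_prod_eigenvalues]; push_cast; rfl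
  have ht : M.trace = ((∑ i, hM.isHermitian.eigenvalues i : ℝ) : ℂ) := by
    rw [hM.isHermitian.trace_eq_sum_eigenvalues]; push_cast; rfl
  rw [hd, ht, Complex.ofReal_re, Complex.ofReal_re,
    Real.log_prod fun i _ => (hM.eigenvalues_pos i).ne', Finset.sum_sub_distrib]

/-- Eigenvalue by eigenvalue this is `log x ≤ x - 1`; strictness away from `x = 1` gives the
equality case below. -/
theorem PosDef.card_le_trace_sub_log_det {M : Matrix d d ℂ} (hM : M.PosDef) :
    (Fintype.card d : ℝ) ≤ M.trace.re - Real.log M.det.re := by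
  rw [hM.trace_sub_log_det]
  calc (Fintype.card d : ℝ) = ∑ _i : d, (1 : ℝ) := by simp
    _ ≤ _ := Finset.sum_le_sum fun i _ => by
      linarith [Real.log_le_sub_one_of_pos (hM.eigenvalues_pos i)]

theorem PosDef.eq_one_of_trace_sub_log_det_le {M : Matrix d d ℂ} (hM : M.PosDef)
    (h : M.trace.re - Real.log M.det.re ≤ Fintype.card d) : M = 1 := by
  have h1 : ∀ i, hM.isHermitian.eigenvalues i = 1 := by
    by_contra! hne
    obtain ⟨i, hi⟩ := hne
    rw [hM.trace_sub_log_det] at h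
    have : ∑ _i : d, (1 : ℝ) < ∑ i, (hM.isHermitian.eigenvalues i
        - Real.log (hM.isHermitian.eigenvalues i)) :=
      Finset.sum_lt_sum (fun i _ => by
        linarith [Real.log_le_sub_one_of_pos (hM.eigenvalues_pos i)])
        ⟨i, Finset.mem_univ i, by
          linarith [Real.log_lt_sub_one_of_pos (hM.eigenvalues_pos i) hi]⟩
    simp only [Finset.sum_const, Finset.card_univ, nsmul_eq_mul, _root_.mul_one] at this
    linarith
  have hd : (RCLike.ofReal ∘ hM.isHermitian.eigenvalues : d → ℂ) = 1 := by
    funext i; simp [h1]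
  rw [hM.isHermitian.spectral_theorem, hd]
  simp

/-- The matrix `M = B E Bᴴ` is positive definite with the trace and determinant of `W E`,
where `W = Bᴴ B`. -/
theorem PosDef.exists_conj {W E : Matrix d d ℂ} (hW : W.PosDef) (hE : E.PosDef) :
    ∃ M : Matrix d d ℂ, M.PosDef ∧ M.trace = (W * E).trace ∧ M.det.re = W.det.re * E.det.re ∧
      (M = 1 → W = E⁻¹) := by
  obtain ⟨B, hB, rfl⟩ := hW.exists_eq_conjTranspose_mul_self
  have hBu : IsUnit B := (isUnit_iff_isUnit_det _).2 hB
  refine ⟨B * E * Bᴴ, ?_, ?_, ?_, fun h => ?_⟩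
  · exact hE.mul_mul_conjTranspose_same (vecMul_injective_of_isUnit hBu)
  · rw [trace_mul_cycle]
  · have : (B * E * Bᴴ).det = (Bᴴ * B).det * E.det := by simp only [det_mul]; ring
    rw [this, ← hW.det_eq_re, ← hE.det_eq_re, ← Complex.ofReal_mul]
    simp
  · have h1 : E * Bᴴ * B = 1 := by
      rw [Matrix.mul_assoc] at h
      exact mul_eq_one_comm.1 h
    symm
    apply inv_eq_right_inv
    rw [← Matrix.mul_assoc, h1]

theorem PosDef.card_le_trace_mul_sub_log_det {W E : Matrix d d ℂ} (hW : W.PosDef)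
    (hE : E.PosDef) :
    Fintype.card d + Real.log E.det.re ≤ (W * E).trace.re - Real.log W.det.re := by
  obtain ⟨M, hM, ht, hd, -⟩ := hW.exists_conj hE
  have := hM.card_le_trace_sub_log_det
  rw [ht, hd, Real.log_mul hW.det_re_pos.ne' hE.det_re_pos.ne'] at this
  linarith

theorem PosDef.eq_inv_of_trace_mul_sub_log_det_le {W E : Matrix d d ℂ} (hW : W.PosDef)
    (hE : E.PosDef)
    (h : (W * E).trace.re - Real.log W.det.re ≤ Fintype.card d + Real.log E.det.re) :
    W = E⁻¹ := by
  obtain ⟨M, hM, ht, hd, h1⟩ := hW.exists_conj hE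
  refine h1 (hM.eq_one_of_trace_sub_log_det_le ?_)
  rw [ht, hd, Real.log_mul hW.det_re_pos.ne' hE.det_re_pos.ne']
  linarith

theorem trace_mul_conj_nonneg {W : Matrix d d ℂ} {C : Matrix n n ℂ} (hW : W.PosSemidef)
    (hC : C.PosSemidef) (U : Matrix n d ℂ) : 0 ≤ (W * (Uᴴ * C * U)).trace.re := by
  obtain ⟨B, rfl⟩ := hW.exists_eq_conjTranspose_mul_self
  have : (Bᴴ * B * (Uᴴ * C * U)).trace = (B * (Uᴴ * C * U) * Bᴴ).trace := by
    rw [Matrix.mul_assoc, trace_mul_comm]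
  rw [this]
  exact ((hC.conjTranspose_mul_mul_same U).mul_mul_conjTranspose_same B).trace_re_nonneg

theorem eq_zero_of_trace_mul_conj {W : Matrix d d ℂ} {C : Matrix n n ℂ} (hW : W.PosDef)
    (hC : C.PosDef) {U : Matrix n d ℂ} (h : (W * (Uᴴ * C * U)).trace.re ≤ 0) : U = 0 := by
  obtain ⟨B, hB, rfl⟩ := hW.exists_eq_conjTranspose_mul_self
  obtain ⟨R, hR, rfl⟩ := hC.exists_eq_conjTranspose_mul_self
  -- The trace is the squared Frobenius norm of `R * U * Bᴴ`, with `R` and `B` invertible.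
  have e : (Bᴴ * B * (Uᴴ * (Rᴴ * R) * U)).trace = ((R * U * Bᴴ)ᴴ * (R * U * Bᴴ)).trace := by
    rw [Matrix.mul_assoc, trace_mul_comm]
    simp only [conjTranspose_mul, conjTranspose_conjTranspose, Matrix.mul_assoc]
  rw [e] at h
  have hp := posSemidef_conjTranspose_mul_self (R * U * Bᴴ)
  have h0 := hp.trace_re_eq_zero (le_antisymm h hp.trace_re_nonneg)
  have h1 := conjTranspose_mul_self_eq_zero.1 h0
  have hBs : IsUnit (Bᴴ).det := by rw [det_conjTranspose]; exact hB.star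
  calc U = R⁻¹ * (R * U * Bᴴ) * (Bᴴ)⁻¹ := by
        rw [Matrix.mul_assoc R, nonsing_inv_mul_cancel_left _ _ hR, mul_nonsing_inv_cancel_right _ _ hBs]
    _ = 0 := by rw [h1]; simp

/-- The MSE matrix of a receiver `U` for the effective channel `V` and noise covariance `A`. -/
def mseMatrix (V : Matrix n d ℂ) (A : Matrix n n ℂ) (U : Matrix n d ℂ) : Matrix d d ℂ :=
  (1 - Uᴴ * V) * (1 - Uᴴ * V)ᴴ + Uᴴ * A * U

/-- The MMSE receiver. -/
def mmseReceiver (V : Matrix n d ℂ) (A : Matrix n n ℂ) : Matrix n d ℂ := (A + V * Vᴴ)⁻¹ * V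

/-- The inverse of the minimal MSE matrix. -/
def mmseWeight (V : Matrix n d ℂ) (A : Matrix n n ℂ) : Matrix d d ℂ :=
  (1 - (mmseReceiver V A)ᴴ * V)⁻¹

variable {V : Matrix n d ℂ} {A : Matrix n n ℂ}

theorem PosDef.add_mul_conjTranspose (hA : A.PosDef) (V : Matrix n d ℂ) : (A + V * Vᴴ).PosDef :=
  hA.add_posSemidef (posSemidef_self_mul_conjTranspose V)

theorem conjTranspose_mmseReceiver (hA : A.PosDef) :
    (mmseReceiver V A)ᴴ = Vᴴ * (A + V * Vᴴ)⁻¹ := by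
  rw [mmseReceiver, conjTranspose_mul, (hA.add_mul_conjTranspose V).inv.isHermitian.eq]

/-- Completion of the square in `U` around the MMSE receiver. -/
theorem mseMatrix_eq (hA : A.PosDef) (U : Matrix n d ℂ) :
    mseMatrix V A U = (1 - (mmseReceiver V A)ᴴ * V)
      + (U - mmseReceiver V A)ᴴ * (A + V * Vᴴ) * (U - mmseReceiver V A) := by
  have hC := (hA.add_mul_conjTranspose V).isUnit_det
  have h1 : (A + V * Vᴴ) * mmseReceiver V A = V := mul_nonsing_inv_cancel_left _ _ hC
  have h2 : (mmseReceiver V A)ᴴ * (A + V * Vᴴ) = Vᴴ := by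
    rw [conjTranspose_mmseReceiver hA, nonsing_inv_mul_cancel_right _ _ hC]
  have h3 : Vᴴ * mmseReceiver V A = (mmseReceiver V A)ᴴ * V := by
    rw [conjTranspose_mmseReceiver hA, mmseReceiver, Matrix.mul_assoc]
  have h4 : (U - mmseReceiver V A)ᴴ * (A + V * Vᴴ) * (U - mmseReceiver V A)
      = Uᴴ * (A + V * Vᴴ) * U - Uᴴ * V - Vᴴ * U + (mmseReceiver V A)ᴴ * V := by
    rw [conjTranspose_sub, Matrix.sub_mul, h2, Matrix.sub_mul, Matrix.mul_sub, Matrix.mul_sub, Matrix.mul_assoc Uᴴ _ (mmseReceiver V A),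
      h1, h3]
    abel
  rw [h4, mseMatrix]
  simp only [conjTranspose_sub, conjTranspose_one, conjTranspose_mul, conjTranspose_conjTranspose,
    Matrix.mul_sub, Matrix.sub_mul, Matrix.mul_one, Matrix.one_mul, Matrix.mul_add, Matrix.add_mul, Matrix.mul_assoc]
  abel

theorem mmse_mul_eq_one (hA : A.PosDef) :
    (1 - (mmseReceiver V A)ᴴ * V) * (1 + Vᴴ * A⁻¹ * V) = 1 := by
  have hC := (hA.add_mul_conjTranspose V).isUnit_det
  have key : (A + V * Vᴴ)⁻¹ * (V * Vᴴ) * A⁻¹ = A⁻¹ - (A + V * Vᴴ)⁻¹ := by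
    have : V * Vᴴ = (A + V * Vᴴ) - A := by abel
    calc (A + V * Vᴴ)⁻¹ * (V * Vᴴ) * A⁻¹ = (A + V * Vᴴ)⁻¹ * ((A + V * Vᴴ) - A) * A⁻¹ := by
          rw [← this]
      _ = A⁻¹ - (A + V * Vᴴ)⁻¹ := by
          rw [Matrix.mul_sub, nonsing_inv_mul _ hC, Matrix.sub_mul, Matrix.one_mul,
            mul_nonsing_inv_cancel_right _ _ hA.isUnit_det]
  rw [conjTranspose_mmseReceiver hA]
  have : Vᴴ * (A + V * Vᴴ)⁻¹ * V * (Vᴴ * A⁻¹ * V)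
      = Vᴴ * ((A + V * Vᴴ)⁻¹ * (V * Vᴴ) * A⁻¹) * V := by simp only [Matrix.mul_assoc]
  rw [Matrix.mul_add, Matrix.mul_one, Matrix.sub_mul, Matrix.one_mul, this, key, Matrix.mul_sub, Matrix.sub_mul]
  abel

theorem mmseWeight_eq (hA : A.PosDef) : mmseWeight V A = 1 + Vᴴ * A⁻¹ * V :=
  inv_eq_right_inv (mmse_mul_eq_one hA)

/-- Unlike positive definiteness, this bound is a closed condition, so it keeps the weights positive
definite in the limit. -/
theorem posSemidef_mmseWeight_sub_one (hA : A.PosDef) : (mmseWeight V A - 1).PosSemidef := by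
  rw [mmseWeight_eq hA, add_sub_cancel_left]
  exact hA.inv.posSemidef.conjTranspose_mul_mul_same V

theorem posDef_of_posSemidef_sub_one {W : Matrix d d ℂ} (h : (W - 1).PosSemidef) : W.PosDef := by
  have := PosDef.one.add_posSemidef h
  rwa [add_sub_cancel] at this

theorem posDef_mmseWeight (hA : A.PosDef) : (mmseWeight V A).PosDef :=
  posDef_of_posSemidef_sub_one (posSemidef_mmseWeight_sub_one hA)

theorem inv_mmseWeight (hA : A.PosDef) : (mmseWeight V A)⁻¹ = 1 - (mmseReceiver V A)ᴴ * V := by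
  rw [mmseWeight_eq hA]
  exact inv_eq_left_inv (mmse_mul_eq_one hA)

theorem posDef_mmse (hA : A.PosDef) : (1 - (mmseReceiver V A)ᴴ * V).PosDef := by
  rw [← inv_mmseWeight hA]
  exact (posDef_mmseWeight hA).inv

/-- Factor `A + V * Vᴴ` out of `A` and apply `det (1 - X * Y) = det (1 - Y * X)`. -/
theorem log_det_mmse (hA : A.PosDef) :
    Real.log (1 - (mmseReceiver V A)ᴴ * V).det.re
      = Real.log A.det.re - Real.log (A + V * Vᴴ).det.re := by
  have hC := hA.add_mul_conjTranspose V
  have h : (A + V * Vᴴ).det * (1 - (mmseReceiver V A)ᴴ * V).det = A.det := by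
    have e : A = (A + V * Vᴴ) * (1 - (A + V * Vᴴ)⁻¹ * V * Vᴴ) := by
      rw [Matrix.mul_sub, Matrix.mul_one, Matrix.mul_assoc,
        mul_nonsing_inv_cancel_left _ _ hC.isUnit_det, add_sub_cancel_right]
    conv_rhs => rw [e, det_mul]
    rw [conjTranspose_mmseReceiver hA, Matrix.mul_assoc, det_one_sub_mul_comm]
  rw [← hC.det_eq_re, ← (posDef_mmse hA).det_eq_re, ← Complex.ofReal_mul] at h
  rw [← h, Complex.ofReal_re, Real.log_mul hC.det_re_pos.ne' (posDef_mmse hA).det_re_pos.ne']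
  ring

/-- The value of the single-user problem: minimizing over the receiver and the weight gives
`d` minus the rate. -/
theorem card_add_log_le_trace_mseMatrix (hA : A.PosDef) {W : Matrix d d ℂ} (hW : W.PosDef)
    (U : Matrix n d ℂ) :
    Fintype.card d + (Real.log A.det.re - Real.log (A + V * Vᴴ).det.re)
      ≤ (W * mseMatrix V A U).trace.re - Real.log W.det.re := by
  have h1 := hW.card_le_trace_mul_sub_log_det (posDef_mmse (V := V) hA)
  have h2 := trace_mul_conj_nonneg hW.posSemidef (hA.add_mul_conjTranspose V).posSemidef
    (U - mmseReceiver V A)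
  rw [log_det_mmse hA] at h1
  rw [mseMatrix_eq hA, Matrix.mul_add, trace_add, Complex.add_re]
  linarith

theorem eq_mmse_of_trace_mseMatrix_le (hA : A.PosDef) {W : Matrix d d ℂ} (hW : W.PosDef)
    {U : Matrix n d ℂ}
    (h : (W * mseMatrix V A U).trace.re - Real.log W.det.re
      ≤ Fintype.card d + (Real.log A.det.re - Real.log (A + V * Vᴴ).det.re)) :
    U = mmseReceiver V A ∧ W = mmseWeight V A := by
  have h1 := hW.card_le_trace_mul_sub_log_det (posDef_mmse (V := V) hA)
  have h2 := trace_mul_conj_nonneg hW.posSemidef (hA.add_mul_conjTranspose V).posSemidef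
    (U - mmseReceiver V A)
  rw [log_det_mmse hA] at h1
  rw [mseMatrix_eq hA, Matrix.mul_add, trace_add, Complex.add_re] at h
  refine ⟨sub_eq_zero.1 (eq_zero_of_trace_mul_conj hW (hA.add_mul_conjTranspose V) ?_),
    hW.eq_inv_of_trace_mul_sub_log_det_le (posDef_mmse hA) ?_⟩
  · linarith
  · rw [log_det_mmse hA]; linarith

theorem trace_mseMatrix_mmse (hA : A.PosDef) :
    (mmseWeight V A * mseMatrix V A (mmseReceiver V A)).trace.re
        - Real.log (mmseWeight V A).det.re
      = Fintype.card d + (Real.log A.det.re - Real.log (A + V * Vᴴ).det.re) := by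
  have hE : mseMatrix V A (mmseReceiver V A) = (mmseWeight V A)⁻¹ := by
    rw [mseMatrix_eq hA, inv_mmseWeight hA]; simp
  have hd : Real.log (mmseWeight V A).det.re = - Real.log (1 - (mmseReceiver V A)ᴴ * V).det.re := by
    have hp := posDef_mmse (V := V) hA
    rw [mmseWeight, det_nonsing_inv, Ring.inverse_eq_inv', ← hp.det_eq_re, ← Complex.ofReal_inv,
      Complex.ofReal_re, Complex.ofReal_re, Real.log_inv]
  rw [hE, mul_nonsing_inv _ (posDef_mmseWeight hA).isUnit_det, hd, log_det_mmse hA]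
  simp only [trace_one, Complex.natCast_re]
  ring

theorem log_det_le_log_det_add (hA : A.PosDef) :
    Real.log A.det.re ≤ Real.log (A + V * Vᴴ).det.re := by
  -- The zero receiver with unit weight has objective value exactly `Fintype.card d`.
  have := card_add_log_le_trace_mseMatrix (V := V) hA PosDef.one (0 : Matrix n d ℂ)
  simp [mseMatrix] at this
  linarith

/-- Equality would make the zero receiver with unit weight optimal; by uniqueness the MMSE receiver,
and with it `V`, would vanish. -/
theorem log_det_lt_log_det_add (hA : A.PosDef) (hV : V ≠ 0) :
    Real.log A.det.re < Real.log (A + V * Vᴴ).det.re := by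
  refine lt_of_le_of_ne (log_det_le_log_det_add hA) fun h => hV ?_
  have h0 := (eq_mmse_of_trace_mseMatrix_le (V := V) hA PosDef.one (U := 0)
    (by simp [mseMatrix, h])).1
  have := mul_nonsing_inv_cancel_left (A + V * Vᴴ) V (hA.add_mul_conjTranspose V).isUnit_det
  rw [← this]
  change _ * mmseReceiver V A = 0
  rw [← h0, Matrix.mul_zero]

end SingleUser

end Matrix

/-! ### Block diagonal weights and convex quadratics -/

namespace Matrix

theorem posDef_blockDiagonal' {ι : Type*} [Fintype ι] [DecidableEq ι] {d : ι → Type*}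
    [∀ i, Fintype (d i)] [∀ i, DecidableEq (d i)] {W : ∀ i, Matrix (d i) (d i) ℂ}
    (hW : ∀ i, (W i).PosDef) : (blockDiagonal' W).PosDef := by
  choose B hB hWB using fun i => (hW i).exists_eq_conjTranspose_mul_self
  have h1 : blockDiagonal' W = (blockDiagonal' B)ᴴ * blockDiagonal' B := by
    rw [blockDiagonal'_conjTranspose, ← blockDiagonal'_mul]
    exact congrArg _ (funext hWB)
  have h2 : IsUnit (blockDiagonal' W) := by
    refine IsUnit.of_mul_eq_one (blockDiagonal' fun i => (W i)⁻¹) ?_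
    rw [← blockDiagonal'_mul]
    simp_rw [mul_nonsing_inv _ (hW _).isUnit_det]
    exact blockDiagonal'_one
  exact (PosSemidef.posDef_iff_isUnit (h1 ▸ posSemidef_conjTranspose_mul_self _)).2 h2

theorem re_trace_conjTranspose {n : Type*} [Fintype n] (A : Matrix n n ℂ) :
    Aᴴ.trace.re = A.trace.re := by
  rw [trace_conjTranspose]; simp

/-- A convex quadratic function of a matrix is minimized where its gradient vanishes. -/
theorem quadratic_le {m d : Type*} [Fintype m] [DecidableEq m] [Fintype d] [DecidableEq d]
    {T : Matrix m m ℂ} (hT : T.PosSemidef) {P₀ G : Matrix m d ℂ} (h : T * P₀ = G)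
    (P : Matrix m d ℂ) :
    (P₀ᴴ * T * P₀).trace.re - 2 * (Gᴴ * P₀).trace.re
      ≤ (Pᴴ * T * P).trace.re - 2 * (Gᴴ * P).trace.re := by
  subst h
  -- The difference of the two sides is the trace of this semidefinite form.
  have h0 := (hT.conjTranspose_mul_mul_same (P - P₀)).trace_re_nonneg
  have hc : (Pᴴ * T * P₀).trace.re = (P₀ᴴ * T * P).trace.re := by
    rw [← re_trace_conjTranspose]
    simp only [conjTranspose_mul, conjTranspose_conjTranspose, hT.isHermitian.eq, Matrix.mul_assoc]
  simp only [conjTranspose_sub, Matrix.sub_mul, Matrix.mul_sub, trace_sub, Complex.sub_re] at h0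
  simp only [conjTranspose_mul, hT.isHermitian.eq]
  linarith

end Matrix

/-! ### The reduced problem in terms of the precoder; optimality of the `X` update -/

namespace MUMIMO

variable {K M : ℕ} {N D : Fin K → ℕ} (S : MUMIMO K M N D)

theorem col_mul {m l : Type} [Fintype l] (A : Matrix m l ℂ) (B : Matrix l (Streams D) ℂ)
    (k : Fin K) : col (A * B) k = A * col B k := rfl

theorem col_smul {m : Type} (c : ℂ) (B : Matrix m (Streams D) ℂ) (k : Fin K) :
    col (c • B) k = c • col B k := rfl

theorem power_nonneg (P : Matrix (Fin M) (Streams D) ℂ) : 0 ≤ power P :=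
  Finset.sum_nonneg fun k _ => (posSemidef_self_mul_conjTranspose (col P k)).trace_re_nonneg

theorem col_eq_zero_of_power_eq_zero {P : Matrix (Fin M) (Streams D) ℂ} (h : power P = 0)
    (k : Fin K) : col P k = 0 := by
  have hp := fun k => posSemidef_self_mul_conjTranspose (col P k)
  have h1 := (Finset.sum_eq_zero_iff_of_nonneg fun k _ => (hp k).trace_re_nonneg).1 h k
    (Finset.mem_univ k)
  exact self_mul_conjTranspose_eq_zero.1 ((hp k).trace_re_eq_zero h1)

theorem redPower_eq (X : Matrix (Rx N) (Streams D) ℂ) : S.redPower X = power (S.Hsᴴ * X) := by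
  refine Finset.sum_congr rfl fun k _ => ?_
  rw [col_mul, Hbar, conjTranspose_mul, conjTranspose_conjTranspose, Matrix.mul_assoc S.Hs,
    Matrix.mul_assoc S.Hs, trace_mul_comm S.Hs, ← Matrix.mul_assoc]

/-- Interference plus noise covariance with noise variance `s`. -/
def covariance (P : Matrix (Fin M) (Streams D) ℂ) (s : ℝ) (k : Fin K) :
    Matrix (Fin (N k)) (Fin (N k)) ℂ :=
  ∑ j ∈ Finset.univ.erase k, S.H k * col P j * (col P j)ᴴ * (S.H k)ᴴ
    + (s : ℂ) • (1 : Matrix (Fin (N k)) (Fin (N k)) ℂ)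

theorem redNoise_eq (X : Matrix (Rx N) (Streams D) ℂ) (k : Fin K) :
    S.redNoise X k = S.covariance (S.Hsᴴ * X) (S.σ k ^ 2 / S.Pmax * power (S.Hsᴴ * X)) k := by
  rw [redNoise, covariance, redPower_eq]
  simp only [col_mul, Hbark, conjTranspose_mul, conjTranspose_conjTranspose, Matrix.mul_assoc]

theorem covariance_add (P : Matrix (Fin M) (Streams D) ℂ) (s : ℝ) (k : Fin K) :
    S.covariance P s k + (S.H k * col P k) * (S.H k * col P k)ᴴ
      = ∑ j, S.H k * col P j * (col P j)ᴴ * (S.H k)ᴴ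
        + (s : ℂ) • (1 : Matrix (Fin (N k)) (Fin (N k)) ℂ) := by
  rw [covariance, ← Finset.sum_erase_add _ _ (Finset.mem_univ k)]
  simp only [conjTranspose_mul, Matrix.mul_assoc]
  abel

theorem posDef_covariance (P : Matrix (Fin M) (Streams D) ℂ) {s : ℝ} (hs : 0 < s) (k : Fin K) :
    (S.covariance P s k).PosDef := by
  refine PosDef.posSemidef_add (posSemidef_sum _ fun j _ => ?_)
    (PosDef.one.smul (Complex.zero_lt_real.2 hs))
  have := posSemidef_self_mul_conjTranspose (S.H k * col P j)
  rwa [conjTranspose_mul, ← Matrix.mul_assoc] at this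

/-- The rate of user `k` with noise variance `s`. -/
def rateWith (P : Matrix (Fin M) (Streams D) ℂ) (s : ℝ) (k : Fin K) : ℝ :=
  Real.log (S.covariance P s k + (S.H k * col P k) * (S.H k * col P k)ᴴ).det.re
    - Real.log (S.covariance P s k).det.re

/-- The weighted sum-MSE objective with noise variances `s` and precoder `P`. -/
def wmseWith (U : ∀ k, Matrix (Fin (N k)) (Fin (D k)) ℂ)
    (W : ∀ k, Matrix (Fin (D k)) (Fin (D k)) ℂ) (P : Matrix (Fin M) (Streams D) ℂ)
    (s : Fin K → ℝ) : ℝ :=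
  ∑ k, S.α k * ((W k * mseMatrix (S.H k * col P k) (S.covariance P (s k) k) (U k)).trace.re
    - Real.log (W k).det.re)

/-- The noise variances, scaled in proportion to the power of the precoder. -/
def scaledNoise (c : ℝ) (k : Fin K) : ℝ := S.σ k ^ 2 / S.Pmax * c

theorem scaledNoise_pos (hσ : ∀ k, 0 < S.σ k) (hP : 0 < S.Pmax) {c : ℝ} (hc : 0 < c) (k : Fin K) :
    0 < S.scaledNoise c k :=
  mul_pos (div_pos (pow_pos (hσ k) 2) hP) hc

theorem wmse_eq (U : ∀ k, Matrix (Fin (N k)) (Fin (D k)) ℂ)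
    (W : ∀ k, Matrix (Fin (D k)) (Fin (D k)) ℂ) (X : Matrix (Rx N) (Streams D) ℂ) :
    S.wmse (U, W, X)
      = S.wmseWith U W (S.Hsᴴ * X) (S.scaledNoise (power (S.Hsᴴ * X))) := by
  refine Finset.sum_congr rfl fun k _ => ?_
  simp only [mse, mseMatrix, redNoise_eq, scaledNoise, col_mul, Hbark, Matrix.mul_assoc]

/-- Noise enters only through the terms `s_k Tr (U_k W_k U_kᴴ)`. With variances proportional to `c`,
the slope in `c` is `eta`; this is the origin of the regularization in the `X` update. -/
theorem wmseWith_sub (U : ∀ k, Matrix (Fin (N k)) (Fin (D k)) ℂ)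
    (W : ∀ k, Matrix (Fin (D k)) (Fin (D k)) ℂ) (P : Matrix (Fin M) (Streams D) ℂ)
    (c c' : ℝ) :
    S.wmseWith U W P (S.scaledNoise c) - S.wmseWith U W P (S.scaledNoise c')
      = S.eta U W * (c - c') := by
  rw [wmseWith, wmseWith, ← Finset.sum_sub_distrib, eta, Finset.sum_mul]
  refine Finset.sum_congr rfl fun k _ => ?_
  have h : ∀ c, (W k * mseMatrix (S.H k * col P k) (S.covariance P (S.scaledNoise c k) k)
      (U k)).trace.re = (W k * mseMatrix (S.H k * col P k) (S.covariance P 0 k) (U k)).trace.re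
        + S.scaledNoise c k * (U k * W k * (U k)ᴴ).trace.re := by
    intro c
    have h1 : S.covariance P (S.scaledNoise c k) k = S.covariance P 0 k
        + ((S.scaledNoise c k : ℝ) : ℂ) • (1 : Matrix (Fin (N k)) (Fin (N k)) ℂ) := by
      simp [covariance]
    have h2 : (W k * ((U k)ᴴ * U k)).trace = (U k * W k * (U k)ᴴ).trace := by
      rw [trace_mul_comm, Matrix.mul_assoc, trace_mul_comm]
    rw [h1, mseMatrix, mseMatrix, Matrix.mul_add (U k)ᴴ, Matrix.add_mul, ← add_assoc, Matrix.mul_add,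
      trace_add, Complex.add_re, Matrix.mul_smul, Matrix.smul_mul, Matrix.mul_one, Matrix.mul_smul,
      trace_smul, h2, smul_eq_mul, Complex.re_ofReal_mul]
  rw [h c, h c', scaledNoise, scaledNoise]
  ring

/-- The Hessian of the weighted sum-MSE with respect to each `P_j`. -/
def precoderHessian (U : ∀ k, Matrix (Fin (N k)) (Fin (D k)) ℂ)
    (W : ∀ k, Matrix (Fin (D k)) (Fin (D k)) ℂ) : Matrix (Fin M) (Fin M) ℂ :=
  ∑ k, (S.H k)ᴴ * (U k * ((S.α k : ℂ) • W k) * (U k)ᴴ) * S.H k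

/-- The linear coefficient of the weighted sum-MSE with respect to `P_j`. -/
def precoderGradient (U : ∀ k, Matrix (Fin (N k)) (Fin (D k)) ℂ)
    (W : ∀ k, Matrix (Fin (D k)) (Fin (D k)) ℂ) (j : Fin K) : Matrix (Fin M) (Fin (D j)) ℂ :=
  (S.H j)ᴴ * (U j * ((S.α j : ℂ) • W j))

/-- Regrouping the received terms by transmitting user separates the objective into one quadratic
per block `P_j`, all with the same Hessian. -/
theorem wmseWith_zero_eq {U : ∀ k, Matrix (Fin (N k)) (Fin (D k)) ℂ}
    {W : ∀ k, Matrix (Fin (D k)) (Fin (D k)) ℂ} (hW : ∀ k, (W k).PosDef)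
    (P : Matrix (Fin M) (Streams D) ℂ) :
    S.wmseWith U W P 0 = ∑ k, S.α k * ((W k).trace.re - Real.log (W k).det.re)
      + ∑ j, (((col P j)ᴴ * S.precoderHessian U W * col P j).trace.re
        - 2 * ((S.precoderGradient U W j)ᴴ * col P j).trace.re) := by
  have h1 : ∀ k, (W k * mseMatrix (S.H k * col P k) (S.covariance P 0 k) (U k)).trace.re
      = (W k).trace.re - 2 * (W k * ((U k)ᴴ * (S.H k * col P k))).trace.re
        + ∑ j, ((col P j)ᴴ * ((S.H k)ᴴ * (U k * W k * (U k)ᴴ) * S.H k) * col P j).trace.re := by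
    intro k
    -- The quadratic part of the signal term supplies the missing index `j = k` of the interference
    -- sum.
    have hE : mseMatrix (S.H k * col P k) (S.covariance P 0 k) (U k)
        = 1 - (U k)ᴴ * (S.H k * col P k) - (S.H k * col P k)ᴴ * U k
          + ∑ j, (U k)ᴴ * (S.H k * col P j * (col P j)ᴴ * (S.H k)ᴴ) * U k := by
      have := S.covariance_add P 0 k
      simp only [Complex.ofReal_zero, zero_smul, add_zero] at this
      rw [← Matrix.sum_mul, ← Matrix.mul_sum, ← this, mseMatrix]
      simp only [conjTranspose_sub, conjTranspose_one, conjTranspose_mul,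
        conjTranspose_conjTranspose, Matrix.mul_sub, Matrix.sub_mul, Matrix.mul_one,
        Matrix.one_mul, Matrix.mul_add, Matrix.add_mul, Matrix.mul_assoc]
      abel
    have hc : (W k * ((S.H k * col P k)ᴴ * U k)).trace.re
        = (W k * ((U k)ᴴ * (S.H k * col P k))).trace.re := by
      rw [← re_trace_conjTranspose, trace_mul_comm (W k) ((U k)ᴴ * _)]
      simp only [conjTranspose_mul, conjTranspose_conjTranspose, (hW k).isHermitian.eq]
    have hq : ∀ j, (W k * ((U k)ᴴ * (S.H k * col P j * (col P j)ᴴ * (S.H k)ᴴ) * U k)).trace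
        = ((col P j)ᴴ * ((S.H k)ᴴ * (U k * W k * (U k)ᴴ) * S.H k) * col P j).trace := by
      intro j
      have := trace_mul_comm (W k * (U k)ᴴ * S.H k * col P j) ((col P j)ᴴ * (S.H k)ᴴ * U k)
      simpa only [Matrix.mul_assoc] using this
    rw [hE]
    simp only [Matrix.mul_add, Matrix.mul_sub, Matrix.mul_one, trace_add, trace_sub,
      Complex.add_re, Complex.sub_re, hc, Matrix.mul_sum, trace_sum, Complex.re_sum, hq]
    ring
  have h2 : ∀ j, ((S.precoderGradient U W j)ᴴ * col P j).trace.re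
      = S.α j * (W j * ((U j)ᴴ * (S.H j * col P j))).trace.re := by
    intro j
    rw [precoderGradient, Matrix.mul_smul, Matrix.mul_smul, conjTranspose_smul, Matrix.smul_mul,
      trace_smul]
    simp only [conjTranspose_mul, conjTranspose_conjTranspose, (hW j).isHermitian.eq,
      Matrix.mul_assoc, smul_eq_mul, Complex.star_def, Complex.conj_ofReal, Complex.re_ofReal_mul]
  have h3 : ∀ j, ((col P j)ᴴ * S.precoderHessian U W * col P j).trace.re
      = ∑ k, S.α k *
        ((col P j)ᴴ * ((S.H k)ᴴ * (U k * W k * (U k)ᴴ) * S.H k) * col P j).trace.re := by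
    intro j
    simp only [precoderHessian, Matrix.mul_sum, Matrix.sum_mul, trace_sum, Complex.re_sum,
      Matrix.mul_smul, Matrix.smul_mul, trace_smul, smul_eq_mul, Complex.re_ofReal_mul]
  simp only [wmseWith, Pi.zero_apply, h1, h2, h3, Finset.sum_sub_distrib, mul_sub, mul_add,
    Finset.sum_add_distrib, Finset.mul_sum]
  rw [Finset.sum_comm (s := Finset.univ (α := Fin K))]
  have : ∀ x, S.α x * (2 * (W x * ((U x)ᴴ * (S.H x * col P x))).trace.re)
    = 2 * (S.α x * (W x * ((U x)ᴴ * (S.H x * col P x))).trace.re) := fun x => by ring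
  simp only [this]
  ring

theorem eta_nonneg (hα : ∀ k, 0 < S.α k) (hP : 0 < S.Pmax)
    {U : ∀ k, Matrix (Fin (N k)) (Fin (D k)) ℂ}
    {W : ∀ k, Matrix (Fin (D k)) (Fin (D k)) ℂ} (hW : ∀ k, (W k).PosDef) : 0 ≤ S.eta U W :=
  Finset.sum_nonneg fun k _ => mul_nonneg
    (mul_nonneg (div_nonneg (sq_nonneg _) hP.le) (hα k).le)
    ((hW k).posSemidef.mul_mul_conjTranspose_same (U k)).trace_re_nonneg

theorem eta_pos (hα : ∀ k, 0 < S.α k) (hσ : ∀ k, 0 < S.σ k) (hP : 0 < S.Pmax)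
    {U : ∀ k, Matrix (Fin (N k)) (Fin (D k)) ℂ}
    {W : ∀ k, Matrix (Fin (D k)) (Fin (D k)) ℂ} (hW : ∀ k, (W k).PosDef)
    (hU : ∃ k, U k ≠ 0) : 0 < S.eta U W := by
  obtain ⟨k, hk⟩ := hU
  refine Finset.sum_pos' (fun k _ => mul_nonneg
    (mul_nonneg (div_nonneg (sq_nonneg _) hP.le) (hα k).le)
    ((hW k).posSemidef.mul_mul_conjTranspose_same (U k)).trace_re_nonneg) ⟨k, Finset.mem_univ k, ?_⟩
  refine mul_pos (mul_pos (div_pos (pow_pos (hσ k) 2) hP) (hα k)) ?_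
  by_contra! h
  refine hk (eq_zero_of_trace_mul_conj (hW k) PosDef.one ?_)
  rwa [Matrix.mul_one, trace_mul_comm, Matrix.mul_assoc, trace_mul_comm]

theorem power_eq (P : Matrix (Fin M) (Streams D) ℂ) :
    power P = ∑ j, ((col P j)ᴴ * col P j).trace.re :=
  Finset.sum_congr rfl fun k _ => by rw [trace_mul_comm]

/-- A precoder satisfying the normal equations minimizes the relaxed objective. -/
theorem wmseWith_le (hα : ∀ k, 0 < S.α k) (hP : 0 < S.Pmax)
    {U : ∀ k, Matrix (Fin (N k)) (Fin (D k)) ℂ}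
    {W : ∀ k, Matrix (Fin (D k)) (Fin (D k)) ℂ} (hW : ∀ k, (W k).PosDef)
    {P₀ : Matrix (Fin M) (Streams D) ℂ}
    (h : ∀ j, (S.precoderHessian U W + (S.eta U W : ℂ) • 1) * col P₀ j
      = S.precoderGradient U W j) (P : Matrix (Fin M) (Streams D) ℂ) :
    S.wmseWith U W P₀ (S.scaledNoise (power P₀)) ≤ S.wmseWith U W P (S.scaledNoise (power P)) := by
  have hz : S.scaledNoise 0 = 0 := by funext k; simp [scaledNoise]
  -- Noise proportional to the power adds `eta` times the power, that is, it shifts the Hessian by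
  -- `eta` times the identity.
  have hF : ∀ Q : Matrix (Fin M) (Streams D) ℂ, S.wmseWith U W Q (S.scaledNoise (power Q))
      = ∑ k, S.α k * ((W k).trace.re - Real.log (W k).det.re)
        + ∑ j, (((col Q j)ᴴ * (S.precoderHessian U W + (S.eta U W : ℂ) • 1) * col Q j).trace.re
        - 2 * ((S.precoderGradient U W j)ᴴ * col Q j).trace.re) := by
    intro Q
    have h1 := S.wmseWith_sub U W Q (power Q) 0
    rw [hz, S.wmseWith_zero_eq hW, sub_zero] at h1
    rw [sub_eq_iff_eq_add.1 h1, power_eq, Finset.mul_sum, add_left_comm, ← Finset.sum_add_distrib]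
    congr 1
    refine Finset.sum_congr rfl fun j _ => ?_
    rw [Matrix.mul_add, Matrix.add_mul, trace_add, Complex.add_re, Matrix.mul_smul,
      Matrix.smul_mul, Matrix.mul_one, trace_smul, smul_eq_mul, Complex.re_ofReal_mul]
    ring
  have hT : (S.precoderHessian U W + (S.eta U W : ℂ) • 1).PosSemidef := by
    refine PosSemidef.add (posSemidef_sum _ fun k _ => ?_)
      (PosSemidef.one.smul (Complex.zero_le_real.2 (S.eta_nonneg hα hP hW)))
    exact (((hW k).posSemidef.smul (Complex.zero_le_real.2 (hα k).le)).mul_mul_conjTranspose_same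
      (U k)).conjTranspose_mul_mul_same (S.H k)
  rw [hF, hF]
  exact add_le_add le_rfl (Finset.sum_le_sum fun j _ => quadratic_le hT (h j) _)

theorem mul_blockDiagonal'_col {d : Fin K → ℕ} (F : ∀ k, Matrix (Fin (N k)) (Fin (d k)) ℂ) (j : Fin K) :
    col (S.Hsᴴ * blockDiagonal' F) j = (S.H j)ᴴ * F j := by
  ext a b
  simp only [col, submatrix_apply, id, Matrix.mul_apply, Fintype.sum_sigma]
  rw [Finset.sum_eq_single j]
  · simp [Hs]
  · intro i _ hi
    exact Finset.sum_eq_zero fun x _ => by rw [blockDiagonal'_apply_ne _ _ _ hi, mul_zero]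
  · simp

theorem mul_blockDiagonal'_mul (F : ∀ k, Matrix (Fin (N k)) (Fin (N k)) ℂ) :
    S.Hsᴴ * blockDiagonal' F * S.Hs = ∑ j, (S.H j)ᴴ * F j * S.H j := by
  ext a b
  simp only [Matrix.mul_apply (M := S.Hsᴴ * blockDiagonal' F), Fintype.sum_sigma, Matrix.sum_apply]
  refine Finset.sum_congr rfl fun j _ => ?_
  rw [Matrix.mul_apply]
  refine Finset.sum_congr rfl fun x _ => ?_
  congr 1
  have := congrFun (congrFun (S.mul_blockDiagonal'_col F j) a) x
  exact this

/-- A push-through identity: `Û Ŵ (η Ŵ⁻¹ + Ûᴴ H̄ Û) = (η I + Û Ŵ Ûᴴ H̄) Û`. Positivity of `eta`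
makes the matrix inverted in the update positive definite. -/
theorem updX_normal (hα : ∀ k, 0 < S.α k) {U : ∀ k, Matrix (Fin (N k)) (Fin (D k)) ℂ}
    {W : ∀ k, Matrix (Fin (D k)) (Fin (D k)) ℂ} (hW : ∀ k, (W k).PosDef)
    (hη : 0 < S.eta U W) (j : Fin K) :
    (S.precoderHessian U W + (S.eta U W : ℂ) • 1) * col (S.Hsᴴ * S.updX U W) j
      = S.precoderGradient U W j := by
  have hWb : (S.blkW W).PosDef :=
    posDef_blockDiagonal' fun k => (hW k).smul (Complex.zero_lt_real.2 (hα k))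
  have hC : ((S.eta U W : ℂ) • (S.blkW W)⁻¹ + (blkU U)ᴴ * S.Hbar * blkU U).PosDef := by
    refine (hWb.inv.smul (Complex.zero_lt_real.2 hη)).add_posSemidef ?_
    exact (posSemidef_self_mul_conjTranspose S.Hs).conjTranspose_mul_mul_same _
  have e1 : S.precoderHessian U W = S.Hsᴴ * (blkU U * S.blkW W * (blkU U)ᴴ) * S.Hs := by
    rw [blkU, blkW, blockDiagonal'_conjTranspose, ← blockDiagonal'_mul, ← blockDiagonal'_mul,
      mul_blockDiagonal'_mul]
    rfl
  have e2 : S.precoderGradient U W j = col (S.Hsᴴ * (blkU U * S.blkW W)) j := by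
    rw [blkU, blkW, ← blockDiagonal'_mul, mul_blockDiagonal'_col]
    rfl
  rw [e1, e2, ← col_mul]
  congr 1
  have e3 : blkU U * S.blkW W * ((S.eta U W : ℂ) • (S.blkW W)⁻¹ + (blkU U)ᴴ * S.Hbar * blkU U)
      = (S.eta U W : ℂ) • blkU U + blkU U * S.blkW W * (blkU U)ᴴ * S.Hbar * blkU U := by
    rw [Matrix.mul_add, Matrix.mul_smul, mul_nonsing_inv_cancel_right _ _ hWb.isUnit_det]
    simp only [Matrix.mul_assoc]
  have e4 : blkU U * S.blkW W = ((S.eta U W : ℂ) • blkU U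
      + blkU U * S.blkW W * (blkU U)ᴴ * S.Hbar * blkU U)
      * ((S.eta U W : ℂ) • (S.blkW W)⁻¹ + (blkU U)ᴴ * S.Hbar * blkU U)⁻¹ := by
    rw [← e3, mul_nonsing_inv_cancel_right _ _ hC.isUnit_det]
  conv_rhs => rw [e4]
  rw [updX, Hbar]
  simp only [Matrix.add_mul, Matrix.mul_add, Matrix.smul_mul, Matrix.mul_smul, Matrix.one_mul,
    Matrix.mul_assoc]
  rw [add_comm]

end MUMIMO

namespace Matrix

theorem isClosed_setOf_posSemidef {n : Type*} [Fintype n] :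
    IsClosed {A : Matrix n n ℂ | A.PosSemidef} := by
  simp only [posSemidef_iff_dotProduct_mulVec, Set.ofPred_and, Set.ofPred_forall, IsHermitian,
    Complex.le_def]
  refine (isClosed_eq (by fun_prop) (by fun_prop)).inter (isClosed_iInter fun x => ?_)
  exact (isClosed_le (by fun_prop) (by fun_prop)).inter (isClosed_eq (by fun_prop) (by fun_prop))

end Matrix

/-! ### Descent of the objective and persistence of the signal -/

namespace MUMIMO

variable {K M : ℕ} {N D : Fin K → ℕ} (S : MUMIMO K M N D)

/-- The weighted number of streams. -/
def weightedStreams : ℝ := ∑ k, S.α k * D k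

/-- The weighted sum-rate with noise variances `s`. -/
def wsrWith (P : Matrix (Fin M) (Streams D) ℂ) (s : Fin K → ℝ) : ℝ :=
  ∑ k, S.α k * S.rateWith P (s k) k

theorem weightedStreams_sub_wsrWith (P : Matrix (Fin M) (Streams D) ℂ) (s : Fin K → ℝ) :
    S.weightedStreams - S.wsrWith P s = ∑ k, S.α k * (Fintype.card (Fin (D k)) +
      (Real.log (S.covariance P (s k) k).det.re - Real.log (S.covariance P (s k) k
        + (S.H k * col P k) * (S.H k * col P k)ᴴ).det.re)) := by
  rw [weightedStreams, wsrWith, ← Finset.sum_sub_distrib]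
  refine Finset.sum_congr rfl fun k _ => ?_
  rw [rateWith, Fintype.card_fin]
  ring

variable {S} in
theorem wmseWith_ge (hα : ∀ k, 0 < S.α k) {s : Fin K → ℝ} (hs : ∀ k, 0 < s k)
    (U : ∀ k, Matrix (Fin (N k)) (Fin (D k)) ℂ)
    {W : ∀ k, Matrix (Fin (D k)) (Fin (D k)) ℂ} (hW : ∀ k, (W k).PosDef)
    (P : Matrix (Fin M) (Streams D) ℂ) :
    S.weightedStreams - S.wsrWith P s ≤ S.wmseWith U W P s := by
  rw [weightedStreams_sub_wsrWith]
  exact Finset.sum_le_sum fun k _ => mul_le_mul_of_nonneg_left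
    (card_add_log_le_trace_mseMatrix (S.posDef_covariance P (hs k) k) (hW k) (U k)) (hα k).le

theorem wmseWith_mmse {s : Fin K → ℝ} (hs : ∀ k, 0 < s k) (P : Matrix (Fin M) (Streams D) ℂ) :
    S.wmseWith (fun k => mmseReceiver (S.H k * col P k) (S.covariance P (s k) k))
      (fun k => mmseWeight (S.H k * col P k) (S.covariance P (s k) k)) P s
      = S.weightedStreams - S.wsrWith P s := by
  rw [weightedStreams_sub_wsrWith]
  exact Finset.sum_congr rfl fun k _ => congrArg _
    (trace_mseMatrix_mmse (S.posDef_covariance P (hs k) k))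

variable {S} in
theorem wsrWith_pos (hα : ∀ k, 0 < S.α k) {s : Fin K → ℝ} (hs : ∀ k, 0 < s k)
    {P : Matrix (Fin M) (Streams D) ℂ} (hP : ∃ k, S.H k * col P k ≠ 0) : 0 < S.wsrWith P s := by
  obtain ⟨k, hk⟩ := hP
  refine Finset.sum_pos' (fun k _ => mul_nonneg (hα k).le (sub_nonneg.2
    (log_det_le_log_det_add (S.posDef_covariance P (hs k) k)))) ⟨k, Finset.mem_univ k, ?_⟩
  exact mul_pos (hα k) (sub_pos.2 (log_det_lt_log_det_add (S.posDef_covariance P (hs k) k) hk))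

-- Without signal the MSE matrix is `1 + Uᴴ A U`, so the trace only grows beyond that of `W`. Zero
-- variances are allowed because a signal-free precoder may have zero power.
variable {S} in
theorem weightedStreams_le_wmseWith (hα : ∀ k, 0 < S.α k) {s : Fin K → ℝ} (hs : ∀ k, 0 ≤ s k)
    (U : ∀ k, Matrix (Fin (N k)) (Fin (D k)) ℂ)
    {W : ∀ k, Matrix (Fin (D k)) (Fin (D k)) ℂ} (hW : ∀ k, (W k).PosDef)
    {P : Matrix (Fin M) (Streams D) ℂ} (hP : ∀ k, S.H k * col P k = 0) :
    S.weightedStreams ≤ S.wmseWith U W P s := by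
  refine Finset.sum_le_sum fun k _ => mul_le_mul_of_nonneg_left ?_ (hα k).le
  have h1 := (hW k).card_le_trace_sub_log_det
  have hc : (S.covariance P (s k) k).PosSemidef := by
    refine PosSemidef.add (posSemidef_sum _ fun j _ => ?_)
      (PosSemidef.one.smul (Complex.zero_le_real.2 (hs k)))
    have := posSemidef_self_mul_conjTranspose (S.H k * col P j)
    rwa [conjTranspose_mul, ← Matrix.mul_assoc] at this
  have h2 := trace_mul_conj_nonneg (hW k).posSemidef hc (U k)
  rw [hP, mseMatrix, Matrix.mul_zero, sub_zero, conjTranspose_one, Matrix.mul_one, Matrix.mul_add,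
    Matrix.mul_one, trace_add, Complex.add_re]
  rw [Fintype.card_fin] at h1
  linarith

/-- Some user receives a nonzero signal from the reduced precoder `X`. -/
def Active (X : Matrix (Rx N) (Streams D) ℂ) : Prop := ∃ k, S.H k * col (S.Hsᴴ * X) k ≠ 0

variable {S} in
theorem Active.power_pos {X : Matrix (Rx N) (Streams D) ℂ} (h : S.Active X) :
    0 < power (S.Hsᴴ * X) := by
  refine lt_of_le_of_ne (power_nonneg _) fun h0 => ?_
  obtain ⟨k, hk⟩ := h
  exact hk (by rw [col_eq_zero_of_power_eq_zero h0.symm, Matrix.mul_zero])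

/-- The noise variances in the reduced problem at `X`. -/
def redNoiseVar (X : Matrix (Rx N) (Streams D) ℂ) : Fin K → ℝ := S.scaledNoise (power (S.Hsᴴ * X))

theorem updU_eq (X : Matrix (Rx N) (Streams D) ℂ) (k : Fin K) :
    S.updU X k = mmseReceiver (S.H k * col (S.Hsᴴ * X) k)
      (S.covariance (S.Hsᴴ * X) (S.redNoiseVar X k) k) := by
  rw [mmseReceiver, covariance_add, updU, ← Finset.mul_sum, redNoiseVar, scaledNoise, ← redPower_eq,
    add_comm, redPower]
  simp only [col_mul, Hbark, conjTranspose_mul, conjTranspose_conjTranspose, Matrix.mul_assoc]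

theorem updW_eq (X : Matrix (Rx N) (Streams D) ℂ) (k : Fin K) :
    S.updW (S.updU X) X k = mmseWeight (S.H k * col (S.Hsᴴ * X) k)
      (S.covariance (S.Hsᴴ * X) (S.redNoiseVar X k) k) := by
  rw [mmseWeight, ← updU_eq, updW]
  simp only [col_mul, Hbark, Matrix.mul_assoc]

section Step

variable {S} (hα : ∀ k, 0 < S.α k) (hσ : ∀ k, 0 < S.σ k) (hP : 0 < S.Pmax)
  {X : Matrix (Rx N) (Streams D) ℂ} (hX : S.Active X)

include hσ hP hX

theorem redNoiseVar_pos (k : Fin K) : 0 < S.redNoiseVar X k :=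
  S.scaledNoise_pos hσ hP hX.power_pos k

theorem posSemidef_updW_sub_one (k : Fin K) : (S.updW (S.updU X) X k - 1).PosSemidef := by
  rw [updW_eq]
  exact posSemidef_mmseWeight_sub_one (S.posDef_covariance _ (redNoiseVar_pos hσ hP hX k) k)

theorem posDef_updW (k : Fin K) : (S.updW (S.updU X) X k).PosDef :=
  posDef_of_posSemidef_sub_one (posSemidef_updW_sub_one hσ hP hX k)

theorem wmse_updW : S.wmse (S.updU X, S.updW (S.updU X) X, X)
    = S.weightedStreams - S.wsrWith (S.Hsᴴ * X) (S.redNoiseVar X) := by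
  rw [wmse_eq, funext (S.updU_eq X), ← funext (S.updU_eq X), funext (S.updW_eq X),
    funext (S.updU_eq X)]
  exact S.wmseWith_mmse (redNoiseVar_pos hσ hP hX) _

theorem exists_updU_ne_zero : ∃ k, S.updU X k ≠ 0 := by
  obtain ⟨k, hk⟩ := hX
  refine ⟨k, fun h => hk ?_⟩
  have hC := (S.posDef_covariance (S.Hsᴴ * X) (redNoiseVar_pos hσ hP ⟨k, hk⟩ k)
    k).add_mul_conjTranspose (S.H k * col (S.Hsᴴ * X) k)
  rw [updU_eq, mmseReceiver] at h
  rw [← mul_nonsing_inv_cancel_left _ (S.H k * col (S.Hsᴴ * X) k) hC.isUnit_det, h,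
    Matrix.mul_zero]

include hα

/-- The comparison is with every precoder, not only those of the form `Hᴴ Y`; the gradient identity
for the sum-rate needs all directions. -/
theorem wmse_updX_le (P : Matrix (Fin M) (Streams D) ℂ) :
    S.wmse (S.updU X, S.updW (S.updU X) X, S.updX (S.updU X) (S.updW (S.updU X) X))
      ≤ S.wmseWith (S.updU X) (S.updW (S.updU X) X) P (S.scaledNoise (power P)) := by
  rw [wmse_eq]
  have hW := posDef_updW hσ hP hX
  exact S.wmseWith_le hα hP hW
    (S.updX_normal hα hW (S.eta_pos hα hσ hP hW (exists_updU_ne_zero hσ hP hX))) P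

theorem wmse_updX_le_sub_wsrWith :
    S.wmse (S.updU X, S.updW (S.updU X) X, S.updX (S.updU X) (S.updW (S.updU X) X))
      ≤ S.weightedStreams - S.wsrWith (S.Hsᴴ * X) (S.redNoiseVar X) := by
  rw [← wmse_updW hσ hP hX, wmse_eq _ _ _ X]
  exact wmse_updX_le hα hσ hP hX _

theorem wmse_updX_lt :
    S.wmse (S.updU X, S.updW (S.updU X) X, S.updX (S.updU X) (S.updW (S.updU X) X))
      < S.weightedStreams :=
  (wmse_updX_le_sub_wsrWith hα hσ hP hX).trans_lt
    (sub_lt_self _ (wsrWith_pos hα (redNoiseVar_pos hσ hP hX) hX))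

end Step

variable {S} in
theorem active_of_wmse_lt (hα : ∀ k, 0 < S.α k) (hP : 0 < S.Pmax)
    {U : ∀ k, Matrix (Fin (N k)) (Fin (D k)) ℂ}
    {W : ∀ k, Matrix (Fin (D k)) (Fin (D k)) ℂ} (hW : ∀ k, (W k).PosDef)
    {X : Matrix (Rx N) (Streams D) ℂ} (h : S.wmse (U, W, X) < S.weightedStreams) :
    S.Active X := by
  by_contra hX
  simp only [Active, not_exists, not_not] at hX
  rw [wmse_eq] at h
  exact h.not_ge (weightedStreams_le_wmseWith hα
    (fun k => mul_nonneg (div_nonneg (sq_nonneg _) hP.le) (power_nonneg _)) U hW hX)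

namespace IsRWMMSE

variable {S} {z : ℕ → Vars N D} (hz : S.IsRWMMSE z)
include hz

theorem succ_eq (n : ℕ) : z (n + 1) = (S.updU (z n).2.2, S.updW (S.updU (z n).2.2) (z n).2.2,
    S.updX (S.updU (z n).2.2) (S.updW (S.updU (z n).2.2) (z n).2.2)) := by
  have h1 := hz.step_U n
  have h2 := hz.step_W n
  have h3 := hz.step_X n
  rw [h1] at h2
  rw [h1, h2] at h3
  exact Prod.ext h1 (Prod.ext h2 h3)

variable (hα : ∀ k, 0 < S.α k) (hσ : ∀ k, 0 < S.σ k) (hP : 0 < S.Pmax)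
include hα hσ hP

theorem active (n : ℕ) : S.Active (z n).2.2 := by
  induction n with
  | zero =>
    obtain ⟨k, hk⟩ := hz.init_ne
    exact ⟨k, by rwa [col_mul, ← Matrix.mul_assoc]⟩
  | succ n ih =>
    rw [hz.succ_eq n]
    exact active_of_wmse_lt hα hP (posDef_updW hσ hP ih) (wmse_updX_lt hα hσ hP ih)

theorem posSemidef_sub_one (n : ℕ) (k : Fin K) : ((z (n + 1)).2.1 k - 1).PosSemidef := by
  rw [hz.succ_eq n]
  exact posSemidef_updW_sub_one hσ hP (hz.active hα hσ hP n) k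

theorem wmse_le (n : ℕ) : S.wmse (z (n + 1)) ≤
    S.weightedStreams - S.wsrWith (S.Hsᴴ * (z n).2.2) (S.redNoiseVar (z n).2.2) := by
  rw [hz.succ_eq n]
  exact wmse_updX_le_sub_wsrWith hα hσ hP (hz.active hα hσ hP n)

/-- The optimal value for the current `X` lies between consecutive objective values. -/
theorem wmse_antitone : Antitone fun n => S.wmse (z (n + 1)) := by
  refine antitone_nat_of_succ_le fun n => (hz.wmse_le hα hσ hP (n + 1)).trans ?_
  have h : S.wmse (z (n + 1)) = S.wmseWith (z (n + 1)).1 (z (n + 1)).2.1 (S.Hsᴴ * (z (n + 1)).2.2)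
    (S.redNoiseVar (z (n + 1)).2.2) := S.wmse_eq _ _ _
  rw [h]
  exact wmseWith_ge hα (redNoiseVar_pos hσ hP (hz.active hα hσ hP (n + 1))) _
    (fun k => posDef_of_posSemidef_sub_one (hz.posSemidef_sub_one hα hσ hP n k)) _

end IsRWMMSE

/-! ### Continuity and passage to a limit point -/

theorem continuous_col {m : Type} (k : Fin K) :
    Continuous fun A : Matrix m (Streams D) ℂ => col A k :=
  continuous_id.matrix_submatrix _ _

theorem continuous_covariance (k : Fin K) :
    Continuous fun y : Matrix (Fin M) (Streams D) ℂ × ℝ => S.covariance y.1 y.2 k := by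
  have hc := fun j => (continuous_col (m := Fin M) (D := D) j)
  unfold covariance
  fun_prop

theorem continuous_power : Continuous (power : Matrix (Fin M) (Streams D) ℂ → ℝ) := by
  have hc := fun j => (continuous_col (m := Fin M) (D := D) j)
  unfold power
  fun_prop

theorem continuousAt_wmseWith {U : ∀ k, Matrix (Fin (N k)) (Fin (D k)) ℂ}
    {W : ∀ k, Matrix (Fin (D k)) (Fin (D k)) ℂ} (hW : ∀ k, (W k).PosDef)
    (P : Matrix (Fin M) (Streams D) ℂ) (c : ℝ) :
    ContinuousAt (fun y : (∀ k, Matrix (Fin (N k)) (Fin (D k)) ℂ) ×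
      (∀ k, Matrix (Fin (D k)) (Fin (D k)) ℂ) × Matrix (Fin M) (Streams D) ℂ × ℝ =>
      S.wmseWith y.1 y.2.1 y.2.2.1 (S.scaledNoise y.2.2.2)) (U, W, P, c) := by
  have hc := fun j => (continuous_col (m := Fin M) (D := D) j)
  have hcov := S.continuous_covariance
  refine tendsto_finsetSum _ fun k _ => Tendsto.const_mul _ (Tendsto.sub ?_ ?_)
  · refine Continuous.tendsto ?_ _
    have := (hcov k).comp (g := _) (f := fun y : (∀ k, Matrix (Fin (N k)) (Fin (D k)) ℂ) ×
      (∀ k, Matrix (Fin (D k)) (Fin (D k)) ℂ) × Matrix (Fin M) (Streams D) ℂ × ℝ =>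
        (y.2.2.1, S.scaledNoise y.2.2.2 k)) (by unfold scaledNoise; fun_prop)
    simp only [Function.comp_def] at this
    unfold mseMatrix
    fun_prop
  · refine ContinuousAt.log (Continuous.continuousAt (by fun_prop)) (hW k).det_re_pos.ne'

theorem continuousAt_wsrWith (P : Matrix (Fin M) (Streams D) ℂ) {c : ℝ}
    (hs : ∀ k, 0 < S.scaledNoise c k) :
    ContinuousAt (fun y : Matrix (Fin M) (Streams D) ℂ × ℝ =>
      S.wsrWith y.1 (S.scaledNoise y.2)) (P, c) := by
  have hc := fun j => (continuous_col (m := Fin M) (D := D) j)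
  refine tendsto_finsetSum _ fun k _ => Tendsto.const_mul _ ?_
  have := (S.continuous_covariance k).comp (g := _) (f := fun y : Matrix (Fin M) (Streams D) ℂ × ℝ =>
        (y.1, S.scaledNoise y.2 k)) (by unfold scaledNoise; fun_prop)
  simp only [Function.comp_def] at this
  have hA := S.posDef_covariance P (hs k) k
  unfold rateWith
  exact Tendsto.sub
    (ContinuousAt.log (Continuous.continuousAt (by fun_prop))
      (hA.add_mul_conjTranspose _).det_re_pos.ne')
    (ContinuousAt.log (Continuous.continuousAt (by fun_prop)) hA.det_re_pos.ne')

variable {S} in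
/-- The properties of a limit point of the R-WMMSE algorithm from which stationarity follows. -/
theorem IsRWMMSE.limit {z : ℕ → Vars N D} (hz : S.IsRWMMSE z)
    (hα : ∀ k, 0 < S.α k) (hσ : ∀ k, 0 < S.σ k) (hP : 0 < S.Pmax)
    {U : ∀ k, Matrix (Fin (N k)) (Fin (D k)) ℂ} {W : ∀ k, Matrix (Fin (D k)) (Fin (D k)) ℂ}
    {X : Matrix (Rx N) (Streams D) ℂ} (hlim : MapClusterPt ((U, W, X) : Vars N D) atTop z) :
    (∀ k, (W k - 1).PosSemidef) ∧ S.Active X ∧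
      (∀ P, S.wmse (U, W, X) ≤ S.wmseWith U W P (S.scaledNoise (power P))) ∧
      S.wmse (U, W, X) ≤ S.weightedStreams - S.wsrWith (S.Hsᴴ * X) (S.redNoiseVar X) := by
  -- Along an ultrafilter finer than `atTop` the limit point is a true limit, and all three
  -- components converge together.
  obtain ⟨F, hF, hzF⟩ := mapClusterPt_iff_ultrafilter.1 hlim
  have hsucc : ∀ {p : ℕ → Prop}, (∀ n, p (n + 1)) → ∀ᶠ n in (F : Filter ℕ), p n := fun hp =>
    hF (eventually_atTop.2 ⟨1, fun n hn => by
      obtain ⟨m, rfl⟩ := Nat.exists_eq_add_of_le' hn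
      exact hp m⟩)
  have hU : Tendsto (fun n => (z n).1) F (𝓝 U) := (continuous_fst.tendsto _).comp hzF
  have hWt : Tendsto (fun n => (z n).2.1) F (𝓝 W) :=
    ((continuous_fst.comp continuous_snd).tendsto _).comp hzF
  have hX : Tendsto (fun n => (z n).2.2) F (𝓝 X) :=
    ((continuous_snd.comp continuous_snd).tendsto _).comp hzF
  have hHX : Tendsto (fun n => S.Hsᴴ * (z n).2.2) F (𝓝 (S.Hsᴴ * X)) :=
    ((by fun_prop : Continuous fun Y : Matrix (Rx N) (Streams D) ℂ => S.Hsᴴ * Y).tendsto X).comp hX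
  have hpow : Tendsto (fun n => power (S.Hsᴴ * (z n).2.2)) F (𝓝 (power (S.Hsᴴ * X))) :=
    (continuous_power.tendsto _).comp hHX
  have hW1 : ∀ k, (W k - 1).PosSemidef := fun k => by
    refine isClosed_setOf_posSemidef.mem_of_tendsto
      ((((continuous_apply k).tendsto W).comp hWt).sub_const 1) ?_
    exact hsucc (p := fun n => ((z n).2.1 k - 1).PosSemidef)
      fun n => hz.posSemidef_sub_one hα hσ hP n k
  have hW : ∀ k, (W k).PosDef := fun k => posDef_of_posSemidef_sub_one (hW1 k)
  have hf : Tendsto (fun n => S.wmse (z n)) F (𝓝 (S.wmse (U, W, X))) := by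
    rw [wmse_eq]
    refine ((S.continuousAt_wmseWith hW (S.Hsᴴ * X) (power (S.Hsᴴ * X))).tendsto.comp
      (hU.prodMk_nhds (hWt.prodMk_nhds (hHX.prodMk_nhds hpow)))).congr fun n => ?_
    exact (S.wmse_eq _ _ _).symm
  -- By monotonicity the limit value is below every iterate's value from the first one on, not only
  -- in the limit along `F`.
  have hle : ∀ n, S.wmse (U, W, X) ≤ S.wmse (z (n + 1)) := fun n =>
    le_of_tendsto hf (hF (eventually_atTop.2 ⟨n + 1, fun m hm => by
      obtain ⟨l, rfl⟩ := Nat.exists_eq_add_of_le' (Nat.one_le_of_lt hm)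
      exact hz.wmse_antitone hα hσ hP (Nat.le_of_succ_le_succ hm)⟩))
  have hact : S.Active X := by
    refine active_of_wmse_lt hα hP hW ((hle 0).trans_lt ?_)
    rw [hz.succ_eq 0]
    exact wmse_updX_lt hα hσ hP (hz.active hα hσ hP 0)
  refine ⟨hW1, hact, fun P => ?_, ?_⟩
  · refine le_of_tendsto_of_tendsto hf ((S.continuousAt_wmseWith hW P (power P)).tendsto.comp
      (hU.prodMk_nhds (hWt.prodMk_nhds (tendsto_const_nhds.prodMk_nhds tendsto_const_nhds))))
      (hsucc fun n => ?_)
    simp only [Function.comp_apply]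
    rw [hz.succ_eq n]
    exact wmse_updX_le hα hσ hP (hz.active hα hσ hP n) P
  -- The value at step `n + 1` is bounded through `X` at step `n`, and `hle` covers step `n + 1`;
  -- convergence of `z (n + 1)` along `F` is never needed.
  · refine ge_of_tendsto (tendsto_const_nhds.sub
      ((S.continuousAt_wsrWith (S.Hsᴴ * X) (redNoiseVar_pos hσ hP hact)).tendsto.comp
        (hHX.prodMk_nhds hpow))) (Eventually.of_forall fun n => ?_)
    exact (hle n).trans (hz.wmse_le hα hσ hP n)

end MUMIMO

/-! ### Differentiability and first-order conditions -/

namespace Matrix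

section Differentiability

variable {E : Type*} [NormedAddCommGroup E] [NormedSpace ℝ E] {m n l : Type*} {x : E}

/-- All entries of `F` are real differentiable at `x`. -/
def EntrywiseDifferentiableAt (F : E → Matrix m n ℂ) (x : E) : Prop :=
  ∀ i j, DifferentiableAt ℝ (fun y => F y i j) x

namespace EntrywiseDifferentiableAt

theorem const (A : Matrix m n ℂ) : EntrywiseDifferentiableAt (fun _ : E => A) x :=
  fun _ _ => differentiableAt_const _

theorem add {F G : E → Matrix m n ℂ} (hF : EntrywiseDifferentiableAt F x)
    (hG : EntrywiseDifferentiableAt G x) : EntrywiseDifferentiableAt (fun y => F y + G y) x :=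
  fun i j => (hF i j).fun_add (hG i j)

theorem sub {F G : E → Matrix m n ℂ} (hF : EntrywiseDifferentiableAt F x)
    (hG : EntrywiseDifferentiableAt G x) : EntrywiseDifferentiableAt (fun y => F y - G y) x :=
  fun i j => (hF i j).fun_sub (hG i j)

theorem sum {ι : Type*} {s : Finset ι} {F : ι → E → Matrix m n ℂ}
    (hF : ∀ i ∈ s, EntrywiseDifferentiableAt (F i) x) :
    EntrywiseDifferentiableAt (fun y => ∑ i ∈ s, F i y) x := fun i j => by
  simp only [Matrix.sum_apply]
  exact DifferentiableAt.fun_sum fun k hk => hF k hk i j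

theorem mul [Fintype n] {F : E → Matrix m n ℂ} {G : E → Matrix n l ℂ}
    (hF : EntrywiseDifferentiableAt F x) (hG : EntrywiseDifferentiableAt G x) :
    EntrywiseDifferentiableAt (fun y => F y * G y) x := fun i j => by
  simp only [Matrix.mul_apply]
  exact DifferentiableAt.fun_sum fun k _ => (hF i k).fun_mul (hG k j)

theorem conjTranspose {F : E → Matrix m n ℂ} (hF : EntrywiseDifferentiableAt F x) :
    EntrywiseDifferentiableAt (fun y => (F y)ᴴ) x := fun i j =>
  (hF j i).star

theorem smul {c : E → ℝ} {F : E → Matrix m n ℂ} (hc : DifferentiableAt ℝ c x)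
    (hF : EntrywiseDifferentiableAt F x) :
    EntrywiseDifferentiableAt (fun y => (c y : ℂ) • F y) x := fun i j =>
  (Complex.ofRealCLM.differentiableAt.comp x hc).fun_mul (hF i j)

theorem trace_re [Fintype n] {F : E → Matrix n n ℂ} (hF : EntrywiseDifferentiableAt F x) :
    DifferentiableAt ℝ (fun y => (F y).trace.re) x :=
  Complex.reCLM.differentiableAt.comp x (DifferentiableAt.fun_sum fun i _ => hF i i)

theorem det_re [Fintype n] [DecidableEq n] {F : E → Matrix n n ℂ}
    (hF : EntrywiseDifferentiableAt F x) : DifferentiableAt ℝ (fun y => (F y).det.re) x := by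
  refine Complex.reCLM.differentiableAt.comp x ?_
  simp only [Matrix.det_apply]
  refine DifferentiableAt.fun_sum fun σ _ => DifferentiableAt.const_smul ?_ _
  classical
  exact (HasFDerivAt.finsetProd fun i _ => (hF (σ i) i).hasFDerivAt).differentiableAt

theorem log_det_re [Fintype n] [DecidableEq n] {F : E → Matrix n n ℂ}
    (hF : EntrywiseDifferentiableAt F x) (h : (F x).PosDef) :
    DifferentiableAt ℝ (fun y => Real.log (F y).det.re) x :=
  hF.det_re.log h.det_re_pos.ne'

end EntrywiseDifferentiableAt

end Differentiability

open scoped MatrixOrder Matrix.Norms.L2Operator in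
theorem IsHermitian.exists_posSemidef_smul_one_sub {n : Type*} [Fintype n] [DecidableEq n]
    {A : Matrix n n ℂ} (hA : A.IsHermitian) :
    ∃ C : ℝ, (C • (1 : Matrix n n ℂ) - A).PosSemidef := by
  refine ⟨‖A‖, ?_⟩
  have h := IsSelfAdjoint.le_algebraMap_norm_self (a := A) hA
  rw [Matrix.le_iff, Algebra.algebraMap_eq_smul_one] at h
  exact h

/-- For `t ≥ 0` this is a convex combination. For `t < 0` the subtracted multiple of `B` is at most
`-t * C < 1` times the identity, which `A ⪰ 1` absorbs. Having both signs of `t` forces derivatives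
to vanish rather than be merely nonnegative. -/
theorem posDef_add_smul_sub {n : Type*} [Fintype n] [DecidableEq n] {A B : Matrix n n ℂ}
    (hA : (A - 1).PosSemidef) (hB : B.PosDef) :
    ∀ᶠ t : ℝ in 𝓝 0, (A + t • (B - A)).PosDef := by
  obtain ⟨C, hCB⟩ := hB.isHermitian.exists_posSemidef_smul_one_sub
  have h1 : ∀ᶠ t : ℝ in 𝓝 0, t < 1 := gt_mem_nhds one_pos
  have h2 : ∀ᶠ t : ℝ in 𝓝 0, -t * C < 1 := by
    have : Tendsto (fun t : ℝ => -t * C) (𝓝 0) (𝓝 (-0 * C)) := by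
      exact (Continuous.tendsto (by fun_prop) 0)
    exact this.eventually (gt_mem_nhds (by simp))
  filter_upwards [h1, h2] with t ht1 ht2
  have hAp := posDef_of_posSemidef_sub_one hA
  rcases le_or_gt 0 t with ht | ht
  · have e : A + t • (B - A) = (1 - t) • A + t • B := by module
    rw [e]
    exact (hAp.smul (sub_pos.2 ht1)).add_posSemidef (hB.posSemidef.smul ht)
  · have e : A + t • (B - A) = ((1 - -t * C) • (1 : Matrix n n ℂ) + (A - 1))
        + ((-t) • A + (-t) • (C • (1 : Matrix n n ℂ) - B)) := by module
    rw [e]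
    refine ((PosDef.one.smul (sub_pos.2 ht2)).add_posSemidef hA).add_posSemidef ?_
    exact (hAp.posSemidef.smul (neg_pos.2 ht).le).add (hCB.smul (neg_pos.2 ht).le)

end Matrix

theorem HasFDerivAt.apply_eq_zero_of_eventually_le {E : Type*} [NormedAddCommGroup E]
    [NormedSpace ℝ E] {f : E → ℝ} {f' : E →L[ℝ] ℝ} {a v : E} (hf : HasFDerivAt f f' a)
    (h : ∀ᶠ t : ℝ in 𝓝 0, f a ≤ f (a + t • v)) : f' v = 0 := by
  have h1 : IsLocalMin (fun t : ℝ => f (a + t • v)) 0 := by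
    filter_upwards [h] with t ht
    simpa using ht
  exact h1.hasDerivAt_eq_zero (hf.hasLineDerivAt v)

section Calculus

variable {E F : Type*} [NormedAddCommGroup E] [NormedSpace ℝ E] [NormedAddCommGroup F]
  [NormedSpace ℝ F]

/-- The derivative is tested only on differences `y - x` with `y ∈ s`; for the weights these are
Hermitian directions. -/
theorem HasFDerivWithinAt.zero_of_apply_sub_eq_zero {f : E → ℝ} {f' : E →L[ℝ] ℝ} {s : Set E}
    {x : E} (hf : HasFDerivWithinAt f f' s x) (h : ∀ y ∈ s, f' (y - x) = 0) :
    HasFDerivWithinAt f (0 : E →L[ℝ] ℝ) s x := by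
  rw [hasFDerivWithinAt_iff_isLittleO] at hf ⊢
  refine hf.congr' ?_ EventuallyEq.rfl
  filter_upwards [self_mem_nhdsWithin] with y hy
  rw [h y hy]
  simp

/-- Both `g` and `h` have derivative opposite to that of the shared term `f`. -/
theorem hasFDerivAt_sub_zero_of_isLocalMin {f g h : E → ℝ} {a : E} (hf : DifferentiableAt ℝ f a)
    (hg : DifferentiableAt ℝ g a) (hh : DifferentiableAt ℝ h a)
    (hfg : IsLocalMin (fun y => f y + g y) a) (hfh : IsLocalMin (fun y => f y + h y) a) :
    HasFDerivAt (fun y => g y - h y) (0 : E →L[ℝ] ℝ) a := by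
  have e1 := hfg.hasFDerivAt_eq_zero (hf.hasFDerivAt.fun_add hg.hasFDerivAt)
  have e2 := hfh.hasFDerivAt_eq_zero (hf.hasFDerivAt.fun_add hh.hasFDerivAt)
  have := hg.hasFDerivAt.fun_sub hh.hasFDerivAt
  rwa [add_left_cancel (e1.trans e2.symm), sub_self] at this

theorem HasFDerivAt.zero_comp_smul {f : E → ℝ} {c : ℝ} {x : E}
    (hf : HasFDerivAt f (0 : E →L[ℝ] ℝ) (c • x)) :
    HasFDerivAt (fun y => f (c • y)) (0 : E →L[ℝ] ℝ) x := by
  have := hf.comp x ((hasFDerivAt_id (𝕜 := ℝ) x).const_smul c)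
  rwa [ContinuousLinearMap.zero_comp] at this

variable {ι : Type*} [Fintype ι] {A B : ι → Type*} [∀ i, NormedAddCommGroup (A i)]
  [∀ i, NormedSpace ℝ (A i)] [∀ i, NormedAddCommGroup (B i)] [∀ i, NormedSpace ℝ (B i)] {i : ι}

theorem DifferentiableAt.comp_fst_apply (z : (∀ i, A i) × (∀ i, B i) × F) {f : A i → ℂ}
    (hf : DifferentiableAt ℝ f (z.1 i)) :
    DifferentiableAt ℝ (fun y : (∀ i, A i) × (∀ i, B i) × F => f (y.1 i)) z :=
  DifferentiableAt.comp (f := fun y : (∀ i, A i) × (∀ i, B i) × F => y.1 i) z hf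
    (differentiableAt_pi.1 differentiableAt_fst i)

theorem DifferentiableAt.comp_snd_fst_apply (z : (∀ i, A i) × (∀ i, B i) × F) {f : B i → ℂ}
    (hf : DifferentiableAt ℝ f (z.2.1 i)) :
    DifferentiableAt ℝ (fun y : (∀ i, A i) × (∀ i, B i) × F => f (y.2.1 i)) z :=
  DifferentiableAt.comp (f := fun y : (∀ i, A i) × (∀ i, B i) × F => y.2.1 i) z hf
    (differentiableAt_pi.1 differentiableAt_snd.fst i)

theorem DifferentiableAt.comp_snd_snd (z : (∀ i, A i) × (∀ i, B i) × F) {f : F → ℂ}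
    (hf : DifferentiableAt ℝ f z.2.2) :
    DifferentiableAt ℝ (fun y : (∀ i, A i) × (∀ i, B i) × F => f y.2.2) z :=
  DifferentiableAt.comp (f := fun y : (∀ i, A i) × (∀ i, B i) × F => y.2.2) z hf
    differentiableAt_snd.snd

end Calculus

/-! ### Smoothness and scaling of the rates -/

namespace MUMIMO

variable {K M : ℕ} {N D : Fin K → ℕ} (S : MUMIMO K M N D)

section Differentiability

variable {E : Type*} [NormedAddCommGroup E] [NormedSpace ℝ E] {x : E}
  {P : E → Matrix (Fin M) (Streams D) ℂ}

theorem entrywiseDifferentiableAt_col {m : Type} {F : E → Matrix m (Streams D) ℂ}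
    (hF : EntrywiseDifferentiableAt F x) (k : Fin K) :
    EntrywiseDifferentiableAt (fun y => col (F y) k) x := fun _ _ => hF _ _

theorem differentiableAt_power (hP : EntrywiseDifferentiableAt P x) :
    DifferentiableAt ℝ (fun y => power (P y)) x :=
  DifferentiableAt.fun_sum fun k _ => ((entrywiseDifferentiableAt_col hP k).mul
    (entrywiseDifferentiableAt_col hP k).conjTranspose).trace_re

theorem entrywiseDifferentiableAt_covariance (hP : EntrywiseDifferentiableAt P x) {s : E → ℝ}
    (hs : DifferentiableAt ℝ s x) (k : Fin K) :
    EntrywiseDifferentiableAt (fun y => S.covariance (P y) (s y) k) x := by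
  refine .add (.sum fun j _ => ?_) (.smul hs (.const _))
  exact (((EntrywiseDifferentiableAt.const _).mul (entrywiseDifferentiableAt_col hP j)).mul
    (entrywiseDifferentiableAt_col hP j).conjTranspose).mul (.const _)

theorem differentiableAt_wmseWith {U : E → ∀ k, Matrix (Fin (N k)) (Fin (D k)) ℂ}
    {W : E → ∀ k, Matrix (Fin (D k)) (Fin (D k)) ℂ}
    (hU : ∀ k, EntrywiseDifferentiableAt (fun y => U y k) x)
    (hW : ∀ k, EntrywiseDifferentiableAt (fun y => W y k) x) (hWx : ∀ k, (W x k).PosDef)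
    (hP : EntrywiseDifferentiableAt P x) {s : E → Fin K → ℝ}
    (hs : ∀ k, DifferentiableAt ℝ (fun y => s y k) x) :
    DifferentiableAt ℝ (fun y => S.wmseWith (U y) (W y) (P y) (s y)) x := by
  refine DifferentiableAt.fun_sum fun k _ => DifferentiableAt.const_mul (.fun_sub ?_ ?_) _
  · have hV : EntrywiseDifferentiableAt (fun y => S.H k * col (P y) k) x :=
      .mul (.const _) (entrywiseDifferentiableAt_col hP k)
    have hE : EntrywiseDifferentiableAt (fun y => 1 - (U y k)ᴴ * (S.H k * col (P y) k)) x :=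
      .sub (.const _) (.mul (hU k).conjTranspose hV)
    exact ((hW k).mul (.add (hE.mul hE.conjTranspose) (.mul (.mul (hU k).conjTranspose
      (S.entrywiseDifferentiableAt_covariance hP (hs k) k)) (hU k)))).trace_re
  · exact (hW k).log_det_re (hWx k)

theorem differentiableAt_wsrWith (hP : EntrywiseDifferentiableAt P x) {s : Fin K → ℝ}
    (hs : ∀ k, 0 < s k) : DifferentiableAt ℝ (fun y => S.wsrWith (P y) s) x := by
  refine DifferentiableAt.fun_sum fun k _ => DifferentiableAt.const_mul (.fun_sub ?_ ?_) _
  · have hV : EntrywiseDifferentiableAt (fun y => S.H k * col (P y) k) x :=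
      .mul (.const _) (entrywiseDifferentiableAt_col hP k)
    exact ((S.entrywiseDifferentiableAt_covariance hP (differentiableAt_const _) k).add
      (hV.mul hV.conjTranspose)).log_det_re
      ((S.posDef_covariance _ (hs k) k).add_mul_conjTranspose _)
  · exact (S.entrywiseDifferentiableAt_covariance hP (differentiableAt_const _) k).log_det_re
      (S.posDef_covariance _ (hs k) k)

end Differentiability

theorem noiseCov_eq (P : Matrix (Fin M) (Streams D) ℂ) (k : Fin K) :
    S.noiseCov P k = S.covariance P (S.σ k ^ 2) k := rfl

variable {S} in
theorem wsr_eq (hσ : ∀ k, 0 < S.σ k) (P : Matrix (Fin M) (Streams D) ℂ) :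
    S.wsr P = S.wsrWith P (fun k => S.σ k ^ 2) := by
  refine Finset.sum_congr rfl fun k _ => congrArg _ ?_
  have hA := S.posDef_covariance P (pow_pos (hσ k) 2) k
  have hC := hA.add_mul_conjTranspose (S.H k * col P k)
  have h : (1 + S.H k * col P k * (col P k)ᴴ * (S.H k)ᴴ * (S.covariance P (S.σ k ^ 2) k)⁻¹).det
      * (S.covariance P (S.σ k ^ 2) k).det
      = (S.covariance P (S.σ k ^ 2) k + (S.H k * col P k) * (S.H k * col P k)ᴴ).det := by
    rw [← det_mul, Matrix.add_mul, Matrix.one_mul, nonsing_inv_mul_cancel_right _ _ hA.isUnit_det]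
    simp only [conjTranspose_mul, Matrix.mul_assoc]
  rw [← hA.det_eq_re, ← hC.det_eq_re] at h
  have h' := congrArg Complex.re h
  rw [Complex.re_mul_ofReal, Complex.ofReal_re] at h'
  rw [rate, rateWith, noiseCov_eq, ← h', ← Real.log_div (by rw [h']; exact hC.det_re_pos.ne')
    hA.det_re_pos.ne', mul_div_cancel_right₀ _ hA.det_re_pos.ne']

theorem covariance_smul (P : Matrix (Fin M) (Streams D) ℂ) (r s : ℝ) (k : Fin K) :
    S.covariance ((r : ℂ) • P) (r ^ 2 * s) k = ((r ^ 2 : ℝ) : ℂ) • S.covariance P s k := by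
  simp only [covariance, col_smul, conjTranspose_smul, Complex.star_def, Complex.conj_ofReal,
    Matrix.mul_smul, Matrix.smul_mul, smul_smul, smul_add, Finset.smul_sum]
  simp only [← Complex.ofReal_mul, sq]

/-- Both determinants gain the same power of `r ^ 2`, which cancels in the difference of logarithms.
-/
theorem rateWith_smul (P : Matrix (Fin M) (Streams D) ℂ) {r s : ℝ} (hr : 0 < r) (hs : 0 < s)
    (k : Fin K) : S.rateWith ((r : ℂ) • P) (r ^ 2 * s) k = S.rateWith P s k := by
  have hA := S.posDef_covariance P hs k
  have hC := hA.add_mul_conjTranspose (S.H k * col P k)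
  have hV : (S.H k * col ((r : ℂ) • P) k) * (S.H k * col ((r : ℂ) • P) k)ᴴ
      = ((r ^ 2 : ℝ) : ℂ) • ((S.H k * col P k) * (S.H k * col P k)ᴴ) := by
    simp only [col_smul, conjTranspose_smul, Complex.star_def, Complex.conj_ofReal,
      Matrix.mul_smul, Matrix.smul_mul, smul_smul]
    simp only [← Complex.ofReal_mul, sq]
  have hr2 : (0 : ℝ) < (r ^ 2) ^ Fintype.card (Fin (N k)) := by positivity
  rw [rateWith, rateWith, covariance_smul, hV, ← smul_add, det_smul, det_smul,
    ← Complex.ofReal_pow, Complex.re_ofReal_mul, Complex.re_ofReal_mul,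
    Real.log_mul hr2.ne' hC.det_re_pos.ne', Real.log_mul hr2.ne' hA.det_re_pos.ne']
  ring

theorem power_smul (P : Matrix (Fin M) (Streams D) ℂ) (r : ℝ) :
    power ((r : ℂ) • P) = r ^ 2 * power P := by
  rw [power, power, Finset.mul_sum]
  refine Finset.sum_congr rfl fun k _ => ?_
  simp only [col_smul, conjTranspose_smul, Complex.star_def, Complex.conj_ofReal,
      Matrix.mul_smul, Matrix.smul_mul, smul_smul, trace_smul, smul_eq_mul]
  rw [← Complex.ofReal_mul, Complex.re_ofReal_mul, sq]

attribute [local instance] Matrix.normedAddCommGroup Matrix.normedSpace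

theorem entrywiseDifferentiableAt_id {m n : Type*} [Fintype m] [Fintype n] (A : Matrix m n ℂ) :
    EntrywiseDifferentiableAt (fun B : Matrix m n ℂ => B) A := fun i j =>
  (differentiableAt_pi.1 (differentiableAt_pi.1 differentiableAt_id i)) j

/-! ### Stationarity at a limit point -/

section Limit

variable {S} (hα : ∀ k, 0 < S.α k) (hσ : ∀ k, 0 < S.σ k) (hP : 0 < S.Pmax)
  {U : ∀ k, Matrix (Fin (N k)) (Fin (D k)) ℂ} {W : ∀ k, Matrix (Fin (D k)) (Fin (D k)) ℂ}
  {X : Matrix (Rx N) (Streams D) ℂ}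
  (hW : ∀ k, (W k - 1).PosSemidef) (hX : S.Active X)
  (hmin : ∀ P, S.wmse (U, W, X) ≤ S.wmseWith U W P (S.scaledNoise (power P)))
  (hval : S.wmse (U, W, X) ≤ S.weightedStreams - S.wsrWith (S.Hsᴴ * X) (S.redNoiseVar X))
include hα hσ hP hW hX hmin hval

theorem isStationaryWMSE_of_blockwise_min : S.IsStationaryWMSE (U, W, X) := by
  have hWp : ∀ k, (W k).PosDef := fun k => posDef_of_posSemidef_sub_one (hW k)
  refine ⟨hWp, ?_⟩
  have hd : DifferentiableAt ℝ S.wmse ((U, W, X) : Vars N D) := by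
    have hXd : EntrywiseDifferentiableAt (fun y : Vars N D => S.Hsᴴ * y.2.2) (U, W, X) := by
      refine .mul (.const _) fun i j => ?_
      exact DifferentiableAt.comp_snd_snd (A := fun k => Matrix (Fin (N k)) (Fin (D k)) ℂ)
        (B := fun k => Matrix (Fin (D k)) (Fin (D k)) ℂ) (F := Matrix (Rx N) (Streams D) ℂ)
        (f := fun B => B i j) (U, W, X) (entrywiseDifferentiableAt_id X i j)
    have : S.wmse = fun y : Vars N D =>
      S.wmseWith y.1 y.2.1 (S.Hsᴴ * y.2.2) (S.scaledNoise (power (S.Hsᴴ * y.2.2))) :=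
      funext fun y => S.wmse_eq _ _ _
    rw [this]
    refine S.differentiableAt_wmseWith (fun k i j => ?_) (fun k i j => ?_) hWp hXd fun k =>
      DifferentiableAt.const_mul (differentiableAt_power hXd) _
    · exact DifferentiableAt.comp_fst_apply (A := fun k => Matrix (Fin (N k)) (Fin (D k)) ℂ)
        (B := fun k => Matrix (Fin (D k)) (Fin (D k)) ℂ) (F := Matrix (Rx N) (Streams D) ℂ)
        (f := fun B => B i j) (U, W, X)
        (entrywiseDifferentiableAt_id (U k) i j)
    · exact DifferentiableAt.comp_snd_fst_apply (A := fun k => Matrix (Fin (N k)) (Fin (D k)) ℂ)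
        (B := fun k => Matrix (Fin (D k)) (Fin (D k)) ℂ) (F := Matrix (Rx N) (Streams D) ℂ)
        (f := fun B => B i j) (U, W, X)
        (entrywiseDifferentiableAt_id (W k) i j)
  obtain ⟨f', hf⟩ := hd
  have hz : ∀ y ∈ wmseDomain N D, f' (y - (U, W, X)) = 0 := by
    rintro ⟨U', W', X'⟩ hy
    have e : ((U', W', X') : Vars N D) - (U, W, X)
        = (U' - U, W' - W, 0) + ((0, 0, X' - X) : Vars N D) := by
      simp
    rw [e, map_add]
    -- With `X` fixed, no admissible `(U, W)` beats `weightedStreams - wsrWith`, and by `hval` the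
    -- limit point is already no larger.
    have h1 : f' (U' - U, W' - W, 0) = 0 := by
      refine hf.apply_eq_zero_of_eventually_le ?_
      filter_upwards [eventually_all.2 fun k => posDef_add_smul_sub (hW k) (hy k)] with t ht
      refine hval.trans ?_
      have := wmseWith_ge hα (redNoiseVar_pos hσ hP hX) (U + t • (U' - U))
        (W := W + t • (W' - W)) ht (S.Hsᴴ * X)
      rw [redNoiseVar, ← wmse_eq] at this
      simpa [redNoiseVar] using this
    have h2 : f' (0, 0, X' - X) = 0 := by
      refine hf.apply_eq_zero_of_eventually_le (Eventually.of_forall fun t => ?_)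
      have := hmin (S.Hsᴴ * (X + t • (X' - X)))
      rw [← wmse_eq] at this
      simpa using this
    rw [h1, h2, add_zero]
  exact hf.hasFDerivWithinAt.zero_of_apply_sub_eq_zero hz

/-- With the noise frozen at its value for `X`, the shared term is `wmseWith U W`. Adding `wsrWith`
gives a minimum since `(U, W)` is optimal for `X`; adding `eta` times the power gives one since `Hᴴ
X` is optimal for `(U, W)`. -/
theorem hasFDerivAt_wsrWith :
    HasFDerivAt (fun Q => S.wsrWith Q (S.redNoiseVar X)
      - S.eta U W * (power Q - power (S.Hsᴴ * X)))
      (0 : Matrix (Fin M) (Streams D) ℂ →L[ℝ] ℝ) (S.Hsᴴ * X) := by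
  have hWp : ∀ k, (W k).PosDef := fun k => posDef_of_posSemidef_sub_one (hW k)
  have hid := entrywiseDifferentiableAt_id (S.Hsᴴ * X)
  have hs := redNoiseVar_pos hσ hP hX
  have d1 : DifferentiableAt ℝ (fun Q => S.wmseWith U W Q (S.redNoiseVar X)) (S.Hsᴴ * X) :=
    S.differentiableAt_wmseWith (fun _ => .const _) (fun _ => .const _) hWp hid
      fun _ => differentiableAt_const _
  have d2 : DifferentiableAt ℝ (fun Q => S.wsrWith Q (S.redNoiseVar X)) (S.Hsᴴ * X) :=
    S.differentiableAt_wsrWith hid hs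
  have d3 : DifferentiableAt ℝ (fun Q : Matrix (Fin M) (Streams D) ℂ =>
      S.eta U W * (power Q - power (S.Hsᴴ * X))) (S.Hsᴴ * X) :=
    ((differentiableAt_power hid).sub_const _).const_mul _
  have h0 := S.wmse_eq U W X
  have m1 : IsLocalMin (fun Q => S.wmseWith U W Q (S.redNoiseVar X)
      + S.wsrWith Q (S.redNoiseVar X)) (S.Hsᴴ * X) := by
    refine Eventually.of_forall fun Q => ?_
    have := wmseWith_ge hα hs U hWp Q
    change S.wmseWith U W (S.Hsᴴ * X) (S.redNoiseVar X) + _ ≤ _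
    rw [redNoiseVar, ← h0]
    rw [redNoiseVar] at this hval
    linarith
  have m2 : IsLocalMin (fun Q => S.wmseWith U W Q (S.redNoiseVar X)
      + S.eta U W * (power Q - power (S.Hsᴴ * X))) (S.Hsᴴ * X) := by
    refine Eventually.of_forall fun Q => ?_
    have h1 := S.wmseWith_sub U W Q (power Q) (power (S.Hsᴴ * X))
    have := hmin Q
    simp only [sub_self, mul_zero, add_zero, redNoiseVar]
    rw [← h0, ← h1]
    linarith
  exact hasFDerivAt_sub_zero_of_isLocalMin d1 d2 d3 m1 m2

theorem isStationaryWSR_of_blockwise_min : S.IsStationaryWSR (S.precoder X) := by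
  have hWp : ∀ k, (W k).PosDef := fun k => posDef_of_posSemidef_sub_one (hW k)
  have hc := hX.power_pos
  have hβ : 0 < S.beta X := by rw [beta, redPower_eq]; exact div_pos hP hc
  have hr := Real.sqrt_pos.2 hβ
  have hr2 : Real.sqrt (S.beta X) ^ 2 = S.beta X := Real.sq_sqrt hβ.le
  have hβc : S.beta X * power (S.Hsᴴ * X) = S.Pmax := by
    rw [beta, redPower_eq, div_mul_cancel₀ _ hc.ne']
  have hpow : power (S.precoder X) = S.Pmax := by rw [precoder, power_smul, hr2, hβc]
  set r := Real.sqrt (S.beta X) with hr_def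
  have hri : ∀ Q : Matrix (Fin M) (Streams D) ℂ, Q = (r : ℂ) • (((r⁻¹ : ℝ) : ℂ) • Q) := fun Q => by
    rw [smul_smul, ← Complex.ofReal_mul, mul_inv_cancel₀ hr.ne', Complex.ofReal_one, one_smul]
  -- The scaled precoder has power `β` times as large, so the multiplier is divided by `β`; the
  -- power constraint is tight.
  refine ⟨hpow.le, S.eta U W / S.beta X, div_nonneg (S.eta_nonneg hα hP hWp) hβ.le,
    by rw [hpow, sub_self, mul_zero], ?_⟩
  have hfun : (fun Q => S.wsr Q - S.eta U W / S.beta X * (power Q - S.Pmax))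
      = (fun Q => S.wsrWith Q (S.redNoiseVar X) - S.eta U W * (power Q - power (S.Hsᴴ * X)))
        ∘ fun Q : Matrix (Fin M) (Streams D) ℂ => ((r⁻¹ : ℝ) : ℂ) • Q := by
    funext Q
    simp only [Function.comp_apply]
    rw [wsr_eq hσ]
    have h1 : S.wsrWith Q (fun k => S.σ k ^ 2)
        = S.wsrWith (((r⁻¹ : ℝ) : ℂ) • Q) (S.redNoiseVar X) := by
      refine Finset.sum_congr rfl fun k _ => congrArg _ ?_
      -- Here `β` is exactly the factor that turns the power-proportional noise back into the true
      -- variance.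
      have e : S.σ k ^ 2 = r ^ 2 * S.redNoiseVar X k := by
        rw [hr2, redNoiseVar, scaledNoise, mul_left_comm, hβc, div_mul_cancel₀ _ hP.ne']
      change S.rateWith Q (S.σ k ^ 2) k = _
      rw [e]
      conv_lhs => rw [hri Q]
      exact S.rateWith_smul _ hr (redNoiseVar_pos hσ hP hX k) k
    have h2 : power Q = S.beta X * power (((r⁻¹ : ℝ) : ℂ) • Q) := by
      conv_lhs => rw [hri Q]
      rw [power_smul, hr2]
    rw [h1, h2, ← hβc]
    field_simp
  rw [hfun]
  have hg := hasFDerivAt_wsrWith hα hσ hP hW hX hmin hval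
  have hp : ((r⁻¹ : ℝ) : ℂ) • S.precoder X = S.Hsᴴ * X := by
    rw [precoder, smul_smul, ← hr_def, ← Complex.ofReal_mul, inv_mul_cancel₀ hr.ne',
      Complex.ofReal_one, one_smul]
  have hsm : ∀ Q : Matrix (Fin M) (Streams D) ℂ, ((r⁻¹ : ℝ) : ℂ) • Q = r⁻¹ • Q := fun Q => by
    ext i j
    simp
  rw [← hp, hsm] at hg
  have := hg.zero_comp_smul
  simp only [← hsm, hp] at this
  exact this

end Limit

end MUMIMO

end

theorem theorem2 {K M : ℕ} {N D : Fin K → ℕ} (S : MUMIMO K M N D)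
    (hα : ∀ k, 0 < S.α k) (hσ : ∀ k, 0 < S.σ k) (hP : 0 < S.Pmax) (hH : S.FullRowRank)
    (z : ℕ → MUMIMO.Vars N D) (hz : S.IsRWMMSE z)
    (Ustar : ∀ k, Matrix (Fin (N k)) (Fin (D k)) ℂ)
    (Wstar : ∀ k, Matrix (Fin (D k)) (Fin (D k)) ℂ)
    (Xstar : Matrix (MUMIMO.Rx N) (MUMIMO.Streams D) ℂ)
    (hlim : MapClusterPt ((Ustar, Wstar, Xstar) : MUMIMO.Vars N D) atTop z) :
    S.IsStationaryWMSE (Ustar, Wstar, Xstar) ∧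
      0 < S.redPower Xstar ∧
      S.IsStationaryWSR (S.precoder Xstar) ∧
      ¬ S.IsTrivial (S.precoder Xstar) := by
  obtain ⟨hW, hX, hmin, hval⟩ := hz.limit hα hσ hP hlim
  have hpos : 0 < S.redPower Xstar := by rw [S.redPower_eq]; exact hX.power_pos
  refine ⟨MUMIMO.isStationaryWMSE_of_blockwise_min hα hσ hP hW hX hmin hval, hpos,
    MUMIMO.isStationaryWSR_of_blockwise_min hα hσ hP hW hX hmin hval, fun h => ?_⟩
  obtain ⟨k, hk⟩ := hX
  have h0 := h k
  rw [MUMIMO.precoder, MUMIMO.col_smul, Matrix.mul_smul] at h0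
  refine hk ((smul_eq_zero.1 h0).resolve_left ?_)
  exact Complex.ofReal_ne_zero.2 (Real.sqrt_pos.2 (div_pos hP hpos)).ne'
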